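/- **Theorem (Energy splitting and distancing have the same order).** Let $1\le k\le n$. Let $\mathrm{Herm}(n)$ be the real vector space of $n\times n$ Hermitian matrices with the Frobenius norm $\|A\|=\sqrt{\operatorname{tr}(A^2)}$, let $\lambda_1(A)\le\dots\le\lambda_n(A)$ be the ordered eigenvalues of $A$, and let $\Sigma_k\subset\mathrm{Herm}(n)$ be the set of matrices with $\lambda_1=\dots=\lambda_k<\lambda_{k+1}$ (the last inequality is void if $k=n$). Write $\overline\lambda=\frac1k\sum_{j\le k}\lambda_j$, $D_k=\sqrt{\frac1k\sum_{j\le k}(\lambda_j-\overline\lambda)^2}$ and $d(A,\Sigma_k)=\inf_{G\in\Sigma_k}\|A-G\|$. *Orders.* If $f:\mathbb R\to\mathbb R$ is given for small $t\ge 0$ by a convergent power series centred at $0$, then $\mathrm{ord}_0(f)\in\{0,1,2,\dots,\infty\}$ denotes the order of this series ($\infty$ for the zero series); for a (vector-valued) function analytic at $0$ it is the usual vanishing order. A minimum over the empty set is $\infty$. *Exact Schrieffer–Wolff decomposition.* Let $H_0'\in\Sigma_k$ be diagonal with increasing diagonal entries. A decomposition of $H\in\mathrm{Herm}(n)$ with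 respect to $H_0'$ is $$H=e^{iS}\,(H_0'+B+T+H_{\mathrm{eff}})\,e^{-iS}$$ with $S,B,T,H_{\mathrm{eff}}\in\mathrm{Herm}(n)$, where $S$ is off-block (its diagonal $k\times k$ and $(n-k)\times(n-k)$ blocks vanish), $B$ is supported in the bottom right $(n-k)\times(n-k)$ block, $T$ is a real scalar matrix in the upper left $k\times k$ block and zero elsewhere, $H_{\mathrm{eff}}\in\mathrm{Herm}_0(k)$ (traceless and supported in the upper left $k\times k$ block), and the first $k$ columns of $e^{iS}$ span the sum of the eigenspaces of $H$ for the eigenvalues $\lambda_1(H),\dots,\lambda_k(H)$. The decomposition with respect to $H_0'$ *is defined on* $\mathcal V$ if $\mathcal V$ is an open neighbourhood of $H_0'$ and there is an open neighbourhood $\mathcal U$ of $0$ in the space of tuples $(S,B,T,H_{\mathrm{eff}})$ such that every $H\in\mathcal V$ has exactly one decomposition with $(S,B,T,H_{\mathrm{eff}})\in\mathcal U$, and this tuple depends real analytically on $H\in\mathcal V$. For every such $H_0'$ there is a $\mathcal V$ on which the decomposition is defined. *Statement.* Let $H(t)\in\mathrm{Herm}(n)$ be a one-parameter family that is real analytic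 at $t=0$, with $H(0)\in\Sigma_k$, and write $\lambda_i(t)=\lambda_i(H(t))$, $\overline\lambda(t)=\overline\lambda(H(t))$. For small $t\ge0$ the functions $\mathfrak s_k(t)=D_k(H(t))$, $\mathfrak s_{i,j}(t)=\lambda_i(t)-\lambda_j(t)$, $\overline{\mathfrak s}_i(t)=\lambda_i(t)-\overline\lambda(t)$ ($1\le i,j\le k$) and $d(H(t),\Sigma_k)$ are given by convergent power series centred at $0$. The five quantities $$\mathrm{ord}_0(\mathfrak s_k),\quad \min_{1\le i<j\le k}\mathrm{ord}_0(\mathfrak s_{i,j}),\quad \min_{1\le i\le k-1}\mathrm{ord}_0(\mathfrak s_{i,i+1}),\quad \mathrm{ord}_0(\mathfrak s_{1,k}),\quad \min_{1\le i\le k}\mathrm{ord}_0(\overline{\mathfrak s}_i)$$ are equal; let $r$ be their common value, the order of energy splitting. Then $$r=\mathrm{ord}_0\bigl(t\mapsto d(H(t),\Sigma_k)\bigr)=\mathrm{ord}_0\bigl(t\mapsto H_{\mathrm{eff}}(t)\bigr)=\min_{1\le j\le k^2-1}\mathrm{ord}_0\bigl(t\mapsto y_j(t)\bigr)$$ for every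 diagonal $H_0'\in\Sigma_k$ with increasing diagonal entries (not necessarily equal to $H(0)$) and every $\mathcal V\ni H(0)$ on which the decomposition with respect to $H_0'$ is defined. Here $H_{\mathrm{eff}}(t)$ is the resulting effective Hamiltonian of $H(t)$, for $t$ near $0$, and $y_1(t),\dots,y_{k^2-1}(t)$ are its coordinates in any fixed basis of $\mathrm{Herm}_0(k)$ (in particular in any orthonormal one); $H_{\mathrm{eff}}(t)$ and the $y_j(t)$ are analytic at $t=0$. -/

import Mathlib

open scoped Matrix.Norms.Frobenius Topology

noncomputable section

namespace SchriefferWolff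

/-- The real vector space `Herm(n)` of `n × n` Hermitian matrices, with the Frobenius norm. -/
abbrev Herm (n : ℕ) : Type :=
  ↥(selfAdjoint.submodule ℝ (Matrix (Fin n) (Fin n) ℂ))

/-- The matrix underlying an element of `Herm n`. -/
abbrev Herm.mat {n : ℕ} (A : Herm n) : Matrix (Fin n) (Fin n) ℂ := A.1

theorem Herm.isHermitian {n : ℕ} (A : Herm n) : A.mat.IsHermitian := A.2

/-- The eigenvalues, with multiplicity, in increasing order (indices start at `0`). -/
def eig {n : ℕ} (A : Herm n) : Fin n → ℝ :=
  A.isHermitian.eigenvalues ∘ Tuple.sort A.isHermitian.eigenvalues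

/-- `Σ_k`: the `k`-fold ground-state degenerate matrices,
`λ₁ = ⋯ = λ_k < λ_{k+1}` (the last condition is void when `k = n`). -/
def degenerate (n k : ℕ) : Set (Herm n) :=
  {A | ∀ i j : Fin n, (i : ℕ) < k →
    ((j : ℕ) < k → eig A i = eig A j) ∧ (k ≤ (j : ℕ) → eig A i < eig A j)}

/-! ### Splitting of the lowest `k` eigenvalues -/

/-- The `k` lowest eigenvalues. -/
def lowEig {n k : ℕ} (hk : k ≤ n) (A : Herm n) (i : Fin k) : ℝ := eig A (Fin.castLE hk i)

/-- The mean of the `k` lowest eigenvalues. -/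
def meanEig {n k : ℕ} (hk : k ≤ n) (A : Herm n) : ℝ := (∑ j, lowEig hk A j) / k

/-- `D_k`: the standard deviation of the `k` lowest eigenvalues. -/
def stdDev {n k : ℕ} (hk : k ≤ n) (A : Herm n) : ℝ :=
  Real.sqrt ((∑ j, (lowEig hk A j - meanEig hk A) ^ 2) / k)

/-- `λ_i - λ_j` for two of the `k` lowest eigenvalues. -/
def splitting {n k : ℕ} (hk : k ≤ n) (i j : Fin k) (A : Herm n) : ℝ :=
  lowEig hk A i - lowEig hk A j

/-- `λ_i - mean` for one of the `k` lowest eigenvalues. -/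
def meanSplitting {n k : ℕ} (hk : k ≤ n) (i : Fin k) (A : Herm n) : ℝ :=
  lowEig hk A i - meanEig hk A

/-! ### Order at `0` of a function that is a power series for `t ≥ 0`

The splitting functions and the distance are in general not differentiable at `0`; their order is
the order of the power series representing them for small `t ≥ 0`. -/

/-- For small `t ≥ 0`, `f` is given by a convergent power series centred at `0`. -/
def RightAnalytic (f : ℝ → ℝ) : Prop :=
  ∃ g : ℝ → ℝ, AnalyticAt ℝ g 0 ∧ f =ᶠ[𝓝[≥] 0] g

open Classical in
/-- The order of that power series (`⊤` for the zero series); only meaningful if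
`RightAnalytic f`. -/
def rightOrd (f : ℝ → ℝ) : ℕ∞ :=
  if h : RightAnalytic f then analyticOrderAt h.choose 0 else 0

theorem rightOrd_eq {f g : ℝ → ℝ} (hg : AnalyticAt ℝ g 0) (hfg : f =ᶠ[𝓝[≥] 0] g) :
    rightOrd f = analyticOrderAt g 0 := by
  have h : RightAnalytic f := ⟨g, hg, hfg⟩
  rw [rightOrd, dif_pos h]
  apply analyticOrderAt_congr
  refine (h.choose_spec.1.frequently_eq_iff_eventually_eq hg).1 ?_
  have h1 : h.choose =ᶠ[𝓝[>] 0] g :=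
    (h.choose_spec.2.symm.trans hfg).filter_mono (nhdsWithin_mono _ Set.Ioi_subset_Ici_self)
  exact h1.frequently.filter_mono (nhdsWithin_mono _ fun x hx => ne_of_gt hx)

/-! ### The exact Schrieffer–Wolff decomposition -/

/-- Off-block matrices: the diagonal `k × k` and `(n-k) × (n-k)` blocks vanish. -/
def offBlock (n k : ℕ) : Submodule ℝ (Herm n) where
  carrier := {A | ∀ i j : Fin n, ((i : ℕ) < k ↔ (j : ℕ) < k) → A.mat i j = 0}
  add_mem' := fun ha hb i j h => by
    have h1 := ha i j h
    have h2 := hb i j h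
    simp_all [Herm.mat]
  zero_mem' := fun i j _ => by simp [Herm.mat]
  smul_mem' := fun c A hA i j h => by
    have h1 := hA i j h
    simp_all [Herm.mat]

/-- Matrices supported in the bottom right `(n-k) × (n-k)` block. -/
def lowerBlock (n k : ℕ) : Submodule ℝ (Herm n) where
  carrier := {A | ∀ i j : Fin n, ((i : ℕ) < k ∨ (j : ℕ) < k) → A.mat i j = 0}
  add_mem' := fun ha hb i j h => by
    have h1 := ha i j h
    have h2 := hb i j h
    simp_all [Herm.mat]
  zero_mem' := fun i j _ => by simp [Herm.mat]
  smul_mem' := fun c A hA i j h => by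
    have h1 := hA i j h
    simp_all [Herm.mat]

/-- `Herm₀(k) ⊆ Herm(n)`: traceless matrices supported in the upper left `k × k` block. -/
def hermZero (n k : ℕ) : Submodule ℝ (Herm n) where
  carrier := {A | (∀ i j : Fin n, (k ≤ (i : ℕ) ∨ k ≤ (j : ℕ)) → A.mat i j = 0) ∧ A.mat.trace = 0}
  add_mem' := fun ha hb => by
    refine ⟨fun i j h => ?_, ?_⟩
    · have h1 := ha.1 i j h
      have h2 := hb.1 i j h
      simp_all [Herm.mat]
    · have h1 := ha.2
      have h2 := hb.2
      simp_all [Herm.mat]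
  zero_mem' := ⟨fun i j _ => by simp [Herm.mat], by simp [Herm.mat]⟩
  smul_mem' := fun c A hA => by
    refine ⟨fun i j h => ?_, ?_⟩
    · have h1 := hA.1 i j h
      simp_all [Herm.mat]
    · have h1 := hA.2
      simp_all [Herm.mat]

/-- The identity of the upper left `k × k` block, extended by zero. -/
def blockOne (n k : ℕ) : Matrix (Fin n) (Fin n) ℂ :=
  Matrix.diagonal fun i => if (i : ℕ) < k then 1 else 0

/-- The ingredients `(S, B, c, H_eff)` of a decomposition; the scalar block is `T = c · blockOne`. -/
abbrev SWData (n k : ℕ) : Type := offBlock n k × lowerBlock n k × ℝ × hermZero n k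

namespace SWData

variable {n k : ℕ}

/-- The exponent `S`. -/
abbrev S (p : SWData n k) : Matrix (Fin n) (Fin n) ℂ := p.1.1.mat
/-- The block `B`. -/
abbrev B (p : SWData n k) : Matrix (Fin n) (Fin n) ℂ := p.2.1.1.mat
/-- The scalar block `T`. -/
abbrev T (p : SWData n k) : Matrix (Fin n) (Fin n) ℂ := (p.2.2.1 : ℂ) • blockOne n k
/-- The traceless effective Hamiltonian. -/
abbrev eff (p : SWData n k) : hermZero n k := p.2.2.2

end SWData

/-- `H = e^{iS} (H₀ + B + T + H_eff) e^{-iS}`, and the first `k` columns of `e^{iS}` span the sum of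
the eigenspaces of `H` for its `k` lowest eigenvalues. -/
structure IsSWDecomposition {n k : ℕ} (hk : k ≤ n) (H₀ H : Herm n) (p : SWData n k) : Prop where
  eq : H.mat = NormedSpace.exp (Complex.I • p.S) * (H₀.mat + p.B + p.T + p.eff.1.mat) *
    NormedSpace.exp (-(Complex.I • p.S))
  lowest : Submodule.span ℂ (Set.range fun j : Fin k =>
      (NormedSpace.exp (Complex.I • p.S)).col (Fin.castLE hk j)) =
    ⨆ j : Fin k, Module.End.eigenspace (Matrix.toLin' H.mat) (lowEig hk H j : ℂ)

/-- A base point: a diagonal element of `Σ_k` whose diagonal entries increase. -/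
structure IsBasePoint {n : ℕ} (k : ℕ) (H₀ : Herm n) : Prop where
  mem : H₀ ∈ degenerate n k
  diag : H₀.mat.IsDiag
  mono : Monotone fun i => (H₀.mat i i).re

/-- A domain on which the exact decomposition with respect to `H₀` is defined: an open neighbourhood
`V` of `H₀` and an open neighbourhood `U` of `0` such that each `H ∈ V` has exactly one decomposition
with data in `U`, depending real analytically on `H`. -/
structure SWDomain {n k : ℕ} (hk : k ≤ n) (H₀ : Herm n) where
  V : Set (Herm n)
  U : Set (SWData n k)
  isOpen_V : IsOpen V
  base_mem : H₀ ∈ V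
  isOpen_U : IsOpen U
  zero_mem : (0 : SWData n k) ∈ U
  data : Herm n → SWData n k
  data_mem : ∀ H ∈ V, data H ∈ U
  isDecomposition : ∀ H ∈ V, IsSWDecomposition hk H₀ H (data H)
  unique : ∀ H ∈ V, ∀ p ∈ U, IsSWDecomposition hk H₀ H p → p = data H
  analytic : AnalyticOnNhd ℝ data V

end SchriefferWolff

end

/-!
Two exact formulas make the distance and the effective Hamiltonian comparable with `D_k`. By the
Hoffman–Wielandt inequality, replacing the `k` lowest eigenvalues of `H` by their mean gives the
nearest point of `Σ_k`, so `d(H, Σ_k) = √k D_k(H)`. The upper left block of `e^{-iS} H e^{iS}` is a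
scalar plus `H_eff` and has eigenvalues `λ₁(H), …, λ_k(H)`; since `H_eff` is traceless, also
`‖H_eff‖ = √k D_k(H)`. The five measures of splitting bound each other up to constants, and the
order of a power series `f` is read off from its growth: it is at least `N` iff `f = O(t ^ N)` as
`t → 0⁺`.

The eigenvalues themselves are power series for `t ≥ 0` by induction on the matrix size (Rellich):
either `H(t)` is scalar, or `H(t) = c(t) + t ^ N g(t)` with `g(0)` not scalar, and then the
Schrieffer–Wolff decomposition analytically block diagonalizes `g` into two smaller blocks. The
decomposition exists by the inverse function theorem, because `S ↦ [iS, H₀']` is an isomorphism of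
the off-block matrices.
-/

namespace SchriefferWolff

open Filter Asymptotics Matrix Polynomial

/-! ### Orders and growth -/

section AnalyticOrder

variable {𝕜 E : Type*} [NontriviallyNormedField 𝕜] [NormedAddCommGroup E] [NormedSpace 𝕜 E]
  {f : 𝕜 → E} {z₀ : 𝕜}

theorem isTheta_pow_of_analyticOrderAt_eq (hf : AnalyticAt 𝕜 f z₀) {m : ℕ}
    (hm : analyticOrderAt f z₀ = m) : f =Θ[𝓝 z₀] fun z => (z - z₀) ^ m := by
  obtain ⟨g, hg, hg₀, hfg⟩ := hf.analyticOrderAt_eq_natCast.1 hm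
  have hg_one : g =Θ[𝓝 z₀] fun _ => (1 : 𝕜) :=
    ((isEquivalent_const_iff_tendsto hg₀).2 hg.continuousAt).isTheta.trans
      (isTheta_const_const hg₀ one_ne_zero)
  refine (EventuallyEq.isTheta hfg).trans ?_
  simpa using (isTheta_refl (fun z => (z - z₀) ^ m) (𝓝 z₀)).smul hg_one

theorem natCast_le_analyticOrderAt_iff_isBigO (hf : AnalyticAt 𝕜 f z₀) {l : Filter 𝕜} [l.NeBot]
    (hl : l ≤ 𝓝[≠] z₀) {N : ℕ} :
    (N : ℕ∞) ≤ analyticOrderAt f z₀ ↔ f =O[l] fun z => (z - z₀) ^ N := by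
  have hl' : l ≤ 𝓝 z₀ := hl.trans nhdsWithin_le_nhds
  rcases eq_or_ne (analyticOrderAt f z₀) ⊤ with htop | htop
  · have hzero : f =ᶠ[l] fun _ => 0 := (analyticOrderAt_eq_top.1 htop).filter_mono hl'
    simpa only [htop, le_top, true_iff] using hzero.trans_isBigO (isBigO_zero _ _)
  obtain ⟨m, hm⟩ := ENat.ne_top_iff_exists.1 htop
  rw [← hm, Nat.cast_le,
    ((isTheta_pow_of_analyticOrderAt_eq hf hm.symm).mono hl').isBigO_congr_left]
  have hlittle {a b : ℕ} (hab : a < b) : (fun z => (z - z₀) ^ b) =o[l] fun z => (z - z₀) ^ a :=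
    (isLittleO_norm_norm.1 (by
      simpa only [norm_pow] using isLittleO_pow_sub_pow_sub z₀ hab)).mono hl'
  rcases lt_trichotomy N m with hNm | rfl | hmN
  · exact iff_of_true hNm.le (hlittle hNm).isBigO
  · exact iff_of_true le_rfl (isBigO_refl _ _)
  · refine iff_of_false hmN.not_ge fun hbig =>
      isLittleO_irrefl ?_ (hbig.trans_isLittleO (hlittle hmN))
    exact Eventually.frequently <| (eventually_mem_nhdsWithin.filter_mono hl).mono
      fun z hz => pow_ne_zero m (sub_ne_zero.2 hz)

variable [CompleteSpace 𝕜] {ι : Type*} [Finite ι] (b : Module.Basis ι 𝕜 E)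

theorem analyticAt_basis_repr (hf : AnalyticAt 𝕜 f z₀) (j : ι) :
    AnalyticAt 𝕜 (fun z => b.repr (f z) j) z₀ :=
  have : FiniteDimensional 𝕜 E := .of_basis b
  ((b.coord j).toContinuousLinearMap.analyticAt _).fun_comp hf

theorem iInf_analyticOrderAt_basis_repr (hf : AnalyticAt 𝕜 f z₀) :
    ⨅ j, analyticOrderAt (fun z => b.repr (f z) j) z₀ = analyticOrderAt f z₀ := by
  have : FiniteDimensional 𝕜 E := .of_basis b
  have := Fintype.ofFinite ι
  refine ENat.eq_of_forall_natCast_le_iff fun N => ?_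
  simp only [le_iInf_iff, natCast_le_analyticOrderAt_iff_isBigO hf le_rfl,
    natCast_le_analyticOrderAt_iff_isBigO (analyticAt_basis_repr b hf _) le_rfl]
  refine ⟨fun h => ?_, fun h j => ((b.coord j).toContinuousLinearMap.isBigO_comp f _).trans h⟩
  have hsum : f = fun z => ∑ j, b.repr (f z) j • b j := funext fun z => (b.sum_repr (f z)).symm
  rw [hsum]
  exact IsBigO.fun_sum fun j _ => by
    simpa using (h j).smul (isBigO_const_const (b j) (one_ne_zero (α := 𝕜)) _)

end AnalyticOrder

section RightAnalytic

variable {f g : ℝ → ℝ}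

theorem RightAnalytic.of_analyticAt (hf : AnalyticAt ℝ f 0) : RightAnalytic f := ⟨f, hf, .rfl⟩

theorem RightAnalytic.congr (hg : RightAnalytic g) (h : f =ᶠ[𝓝[≥] 0] g) : RightAnalytic f := by
  obtain ⟨u, hu, hgu⟩ := hg
  exact ⟨u, hu, h.trans hgu⟩

theorem RightAnalytic.add (hf : RightAnalytic f) (hg : RightAnalytic g) :
    RightAnalytic fun t => f t + g t := by
  obtain ⟨u, hu, hfu⟩ := hf
  obtain ⟨v, hv, hgv⟩ := hg
  exact ⟨fun t => u t + v t, hu.fun_add hv, hfu.add hgv⟩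

theorem RightAnalytic.sub (hf : RightAnalytic f) (hg : RightAnalytic g) :
    RightAnalytic fun t => f t - g t := by
  obtain ⟨u, hu, hfu⟩ := hf
  obtain ⟨v, hv, hgv⟩ := hg
  exact ⟨fun t => u t - v t, hu.fun_sub hv, hfu.sub hgv⟩

theorem RightAnalytic.mul (hf : RightAnalytic f) (hg : RightAnalytic g) :
    RightAnalytic fun t => f t * g t := by
  obtain ⟨u, hu, hfu⟩ := hf
  obtain ⟨v, hv, hgv⟩ := hg
  exact ⟨fun t => u t * v t, hu.fun_mul hv, hfu.mul hgv⟩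

theorem RightAnalytic.sum {ι : Type*} {s : Finset ι} {f : ι → ℝ → ℝ}
    (hf : ∀ i ∈ s, RightAnalytic (f i)) : RightAnalytic fun t => ∑ i ∈ s, f i t := by
  choose! u hu hfu using hf
  refine ⟨fun t => ∑ i ∈ s, u i t, s.analyticAt_fun_sum hu, ?_⟩
  filter_upwards [s.eventually_all.2 hfu] with t ht using Finset.sum_congr rfl ht

theorem rightAnalytic_norm {E : Type*} [NormedAddCommGroup E] [InnerProductSpace ℝ E]
    {F : ℝ → E} (hF : AnalyticAt ℝ F 0) : RightAnalytic fun t => ‖F t‖ := by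
  rcases eq_or_ne (analyticOrderAt F 0) ⊤ with htop | htop
  · refine ⟨fun _ => 0, analyticAt_const, ?_⟩
    filter_upwards [(analyticOrderAt_eq_top.1 htop).filter_mono nhdsWithin_le_nhds] with t ht
    rw [ht, norm_zero]
  · obtain ⟨m, hm⟩ := ENat.ne_top_iff_exists.1 htop
    obtain ⟨G, hG, hG₀, hFG⟩ := hF.analyticOrderAt_eq_natCast.1 hm.symm
    have hG_norm : AnalyticAt ℝ (fun t => ‖G t‖) 0 :=
      AnalyticAt.fun_comp (contDiffAt_norm ℝ hG₀).analyticAt hG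
    refine ⟨fun t => t ^ m * ‖G t‖, by fun_prop, ?_⟩
    filter_upwards [hFG.filter_mono nhdsWithin_le_nhds, self_mem_nhdsWithin] with t ht (ht₀ : 0 ≤ t)
    rw [ht, sub_zero, norm_smul, norm_pow, Real.norm_of_nonneg ht₀]

theorem RightAnalytic.sqrt_sum_sq {ι : Type*} [Fintype ι] {f : ι → ℝ → ℝ}
    (hf : ∀ i, RightAnalytic (f i)) : RightAnalytic fun t => √(∑ i, f i t ^ 2) := by
  choose u hu hfu using hf
  have hU : AnalyticAt ℝ (fun t => (EuclideanSpace.equiv ι ℝ).symm fun i => u i t) 0 :=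
    ((EuclideanSpace.equiv ι ℝ).symm.toContinuousLinearMap.analyticAt _).fun_comp
      (analyticAt_pi_iff.2 hu)
  refine (rightAnalytic_norm hU).congr ?_
  filter_upwards [eventually_all.2 hfu] with t ht
  simp [EuclideanSpace.norm_eq, ht]

theorem RightAnalytic.natCast_le_rightOrd_iff (hf : RightAnalytic f) {N : ℕ} :
    (N : ℕ∞) ≤ rightOrd f ↔ f =O[𝓝[>] 0] fun t => t ^ N := by
  obtain ⟨u, hu, hfu⟩ := hf
  rw [rightOrd_eq hu hfu,
    natCast_le_analyticOrderAt_iff_isBigO hu (nhdsGT_le_nhdsNE 0)]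
  simp only [sub_zero]
  exact isBigO_congr (hfu.symm.filter_mono (nhdsWithin_mono _ Set.Ioi_subset_Ici_self)) .rfl

theorem RightAnalytic.rightOrd_eq_of_isTheta (hf : RightAnalytic f) (hg : RightAnalytic g)
    (h : f =Θ[𝓝[>] 0] g) : rightOrd f = rightOrd g :=
  ENat.eq_of_forall_natCast_le_iff fun N => by
    rw [hf.natCast_le_rightOrd_iff, hg.natCast_le_rightOrd_iff, h.isBigO_congr_left]

theorem analyticOrderAt_eq_rightOrd_of_isTheta {E : Type*} [NormedAddCommGroup E]
    [NormedSpace ℝ E] {F : ℝ → E} (hF : AnalyticAt ℝ F 0) (hg : RightAnalytic g)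
    (h : F =Θ[𝓝[>] 0] g) : analyticOrderAt F 0 = rightOrd g :=
  ENat.eq_of_forall_natCast_le_iff fun N => by
    rw [natCast_le_analyticOrderAt_iff_isBigO hF (nhdsGT_le_nhdsNE 0),
      hg.natCast_le_rightOrd_iff, h.isBigO_congr_left]
    simp only [sub_zero]

end RightAnalytic

/-! ### Spread of finitely many reals -/

section Spread

variable {ι : Type*} [Fintype ι] {l : ι → ℝ}

theorem abs_sub_mean_le {c : ℝ} (h : ∀ i j, |l i - l j| ≤ c) (i : ι) :
    |l i - (∑ j, l j) / Fintype.card ι| ≤ c := by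
  have hcard : (0 : ℝ) < Fintype.card ι := by exact_mod_cast Fintype.card_pos_iff.2 ⟨i⟩
  have hmean : l i - (∑ j, l j) / Fintype.card ι = (∑ j, (l i - l j)) / Fintype.card ι := by
    simp only [Finset.sum_sub_distrib, Finset.sum_const, Finset.card_univ, nsmul_eq_mul]
    field_simp
  rw [hmean, abs_div, abs_of_pos hcard, div_le_iff₀ hcard]
  calc |∑ j, (l i - l j)| ≤ ∑ j, |l i - l j| := Finset.abs_sum_le_sum_abs _ _
    _ ≤ ∑ _j : ι, c := Finset.sum_le_sum fun j _ => h i j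
    _ = c * Fintype.card ι := by simp [mul_comm]

theorem sqrt_mean_sq_le {c : ℝ} (hc : 0 ≤ c) (h : ∀ i, |l i| ≤ c) :
    √((∑ i, l i ^ 2) / Fintype.card ι) ≤ c := by
  rw [Real.sqrt_le_left hc]
  refine div_le_of_le_mul₀ (Nat.cast_nonneg _) (sq_nonneg c) ?_
  calc ∑ i, l i ^ 2 ≤ ∑ _i : ι, c ^ 2 := Finset.sum_le_sum fun i _ => sq_le_sq.2
        ((h i).trans (le_abs_self c))
    _ = c ^ 2 * Fintype.card ι := by simp [mul_comm]

theorem abs_le_sqrt_card_mul_sqrt_mean_sq (i : ι) :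
    |l i| ≤ √(Fintype.card ι) * √((∑ j, l j ^ 2) / Fintype.card ι) := by
  have hcard : (0 : ℝ) < Fintype.card ι := by exact_mod_cast Fintype.card_pos_iff.2 ⟨i⟩
  rw [← Real.sqrt_mul hcard.le, mul_div_cancel₀ _ hcard.ne', ← Real.sqrt_sq_eq_abs]
  exact Real.sqrt_le_sqrt (Finset.single_le_sum (f := fun i => l i ^ 2)
    (fun _ _ => sq_nonneg _) (Finset.mem_univ i))

theorem sum_sq_sub_mean_le (a : ℝ) :
    ∑ i, (l i - (∑ j, l j) / Fintype.card ι) ^ 2 ≤ ∑ i, (l i - a) ^ 2 := by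
  cases isEmpty_or_nonempty ι
  · simp
  set m := (∑ j, l j) / Fintype.card ι
  have hdev : ∑ i, (l i - m) = 0 := by
    simp only [m, Finset.sum_sub_distrib, Finset.sum_const, Finset.card_univ, nsmul_eq_mul]
    field_simp
    ring
  calc ∑ i, (l i - m) ^ 2
      ≤ ∑ i, (l i - m) ^ 2 + Fintype.card ι * (m - a) ^ 2 := le_add_of_nonneg_right (by positivity)
    _ = ∑ i, (l i - m) ^ 2 + 2 * (m - a) * ∑ i, (l i - m) + ∑ _i : ι, (m - a) ^ 2 := by
        simp [hdev]
    _ = ∑ i, (l i - a) ^ 2 := by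
        rw [Finset.mul_sum, ← Finset.sum_add_distrib, ← Finset.sum_add_distrib]
        exact Finset.sum_congr rfl fun i _ => by ring

end Spread

section OrderedSpread

variable {k : ℕ} (hk : 1 ≤ k)

theorem abs_sub_le_abs_first_sub_last {l : Fin k → ℝ} (hl : Monotone l) (i j : Fin k) :
    |l i - l j| ≤ |l ⟨0, by omega⟩ - l ⟨k - 1, by omega⟩| := by
  have hfirst (i : Fin k) : l ⟨0, by omega⟩ ≤ l i := hl (by simp [Fin.le_def])
  have hlast (i : Fin k) : l i ≤ l ⟨k - 1, by omega⟩ := hl (by simp [Fin.le_def]; omega)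
  rw [abs_sub_comm (l ⟨0, _⟩)]
  exact (abs_sub_le_of_le_of_le (hfirst i) (hlast i) (hfirst j) (hlast j)).trans (le_abs_self _)

theorem splitting_isBigO_tfae {X F : Type*} [Norm F] {L : Filter X} {g : X → F}
    {l : Fin k → X → ℝ} (hl : ∀ x, Monotone fun i => l i x) :
    List.TFAE [
      (fun x => √((∑ i, (l i x - (∑ j, l j x) / k) ^ 2) / k)) =O[L] g,
      ∀ i j : Fin k, i < j → (fun x => l i x - l j x) =O[L] g,
      ∀ i j : Fin k, (i : ℕ) + 1 = j → (fun x => l i x - l j x) =O[L] g,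
      (fun x => l ⟨0, by omega⟩ x - l ⟨k - 1, by omega⟩ x) =O[L] g,
      ∀ i : Fin k, (fun x => l i x - (∑ j, l j x) / k) =O[L] g] := by
  have habs_sub_mean (x : X) (i : Fin k) : |l i x - (∑ j, l j x) / k| ≤
      |l ⟨0, by omega⟩ x - l ⟨k - 1, by omega⟩ x| := by
    simpa using abs_sub_mean_le (abs_sub_le_abs_first_sub_last hk (hl x)) i
  tfae_have 2 → 3 := fun h i j hij => h i j (by rw [Fin.lt_def]; omega)
  tfae_have 3 → 4 := by
    intro h
    have hfirst (m : ℕ) (hm : m < k) : (fun x => l ⟨0, by omega⟩ x - l ⟨m, hm⟩ x) =O[L] g := by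
      induction m with
      | zero => simpa using isBigO_zero g L
      | succ m ih => simpa using (ih (by omega)).add (h ⟨m, by omega⟩ ⟨m + 1, hm⟩ rfl)
    exact hfirst _ _
  tfae_have 4 → 5 := fun h i => (isBigO_of_le _ fun x => habs_sub_mean x i).trans h
  tfae_have 5 → 2 := fun h i j _ => by simpa using (h i).sub (h j)
  tfae_have 4 → 1 := fun h => (isBigO_of_le _ fun x => by
    rw [Real.norm_of_nonneg (Real.sqrt_nonneg _)]
    simpa using sqrt_mean_sq_le (abs_nonneg _) (habs_sub_mean x)).trans h
  tfae_have 1 → 5 := fun h i => (IsBigO.of_bound √k (.of_forall fun x => by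
    rw [Real.norm_of_nonneg (Real.sqrt_nonneg _)]
    simpa using abs_le_sqrt_card_mul_sqrt_mean_sq
      (l := fun i => l i x - (∑ j, l j x) / k) i)).trans h
  tfae_finish

end OrderedSpread

/-! ### The Hoffman–Wielandt inequality -/

section Frobenius

variable {𝕜 m n : Type*} [RCLike 𝕜] [Fintype m] [Fintype n]

theorem frobenius_norm_sq (A : Matrix m n 𝕜) : ‖A‖ ^ 2 = ∑ i, ∑ j, ‖A i j‖ ^ 2 := by
  rw [frobenius_norm_def, ← Real.sqrt_eq_rpow, Real.sq_sqrt (by positivity)]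
  simp only [Real.rpow_ofNat]

theorem frobenius_norm_sq_eq_trace (A : Matrix m n 𝕜) : ((‖A‖ ^ 2 : ℝ) : 𝕜) = trace (Aᴴ * A) := by
  rw [frobenius_norm_sq, Finset.sum_comm]
  simp only [trace, diag_apply, mul_apply, conjTranspose_apply, RCLike.ofReal_sum,
    RCLike.ofReal_pow, ← RCLike.conj_mul, RCLike.star_def]

theorem frobenius_norm_unitary_mul [DecidableEq m] {U : Matrix m m 𝕜} (hU : U ∈ unitaryGroup m 𝕜)
    (A : Matrix m n 𝕜) : ‖U * A‖ = ‖A‖ := by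
  refine (sq_eq_sq₀ (norm_nonneg _) (norm_nonneg _)).1 (RCLike.ofReal_injective (K := 𝕜) ?_)
  rw [frobenius_norm_sq_eq_trace, frobenius_norm_sq_eq_trace, conjTranspose_mul, Matrix.mul_assoc,
    ← Matrix.mul_assoc Uᴴ, ← star_eq_conjTranspose U, Unitary.star_mul_self_of_mem hU,
    Matrix.one_mul]

theorem frobenius_norm_mul_unitary [DecidableEq n] {U : Matrix n n 𝕜} (hU : U ∈ unitaryGroup n 𝕜)
    (A : Matrix m n 𝕜) : ‖A * U‖ = ‖A‖ := by
  rw [← frobenius_norm_conjTranspose, conjTranspose_mul, ← star_eq_conjTranspose U,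
    frobenius_norm_unitary_mul (Unitary.star_mem hU), frobenius_norm_conjTranspose]

theorem normSq_mem_doublyStochastic_of_mem_unitaryGroup [DecidableEq n] {U : Matrix n n 𝕜}
    (hU : U ∈ unitaryGroup n 𝕜) : (Matrix.of fun i j => ‖U i j‖ ^ 2) ∈ doublyStochastic ℝ n := by
  refine mem_doublyStochastic_iff_sum.2 ⟨fun i j => sq_nonneg _, fun i => ?_, fun j => ?_⟩
  · apply RCLike.ofReal_injective (K := 𝕜)
    simpa [mul_apply, RCLike.mul_conj] using
      congrArg (fun A : Matrix n n 𝕜 => A i i) (Unitary.mul_star_self_of_mem hU)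
  · apply RCLike.ofReal_injective (K := 𝕜)
    simpa [mul_apply, RCLike.conj_mul] using
      congrArg (fun A : Matrix n n 𝕜 => A j j) (Unitary.star_mul_self_of_mem hU)

end Frobenius

section DoublyStochastic

variable {ι : Type*} [Fintype ι] {a b : ι → ℝ}

theorem sum_sq_sub_le_sum_sq_sub_comp_perm (hab : Monovary a b) (σ : Equiv.Perm ι) :
    ∑ i, (a i - b i) ^ 2 ≤ ∑ i, (a i - b (σ i)) ^ 2 := by
  have hexpand (c : ι → ℝ) :
      ∑ i, (a i - c i) ^ 2 = ∑ i, a i ^ 2 - 2 * ∑ i, a i * c i + ∑ i, c i ^ 2 := by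
    simp only [sub_sq, Finset.sum_add_distrib, Finset.sum_sub_distrib, Finset.mul_sum, mul_assoc]
  rw [hexpand, hexpand fun i => b (σ i), Equiv.sum_comp σ fun i => b i ^ 2]
  linarith [hab.sum_mul_comp_perm_le_sum_mul (σ := σ)]

/-- By Birkhoff's theorem it suffices to consider permutation matrices. -/
theorem sum_sq_sub_le_sum_doublyStochastic [DecidableEq ι] (hab : Monovary a b)
    {M : Matrix ι ι ℝ} (hM : M ∈ doublyStochastic ℝ ι) :
    ∑ i, (a i - b i) ^ 2 ≤ ∑ i, ∑ j, M i j * (a i - b j) ^ 2 := by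
  obtain ⟨w, hw_nonneg, hw_sum, rfl⟩ := exists_eq_sum_perm_of_mem_doublyStochastic hM
  calc ∑ i, (a i - b i) ^ 2 = ∑ σ, w σ * ∑ i, (a i - b i) ^ 2 := by
        rw [← Finset.sum_mul, hw_sum, one_mul]
    _ ≤ ∑ σ, w σ * ∑ i, (a i - b (σ i)) ^ 2 := Finset.sum_le_sum fun σ _ =>
        mul_le_mul_of_nonneg_left (sum_sq_sub_le_sum_sq_sub_comp_perm hab σ) (hw_nonneg σ)
    _ = ∑ σ, ∑ i, ∑ j, (w σ • σ.permMatrix ℝ) i j * (a i - b j) ^ 2 := by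
        refine Finset.sum_congr rfl fun σ _ => ?_
        rw [Finset.mul_sum]
        refine Finset.sum_congr rfl fun i _ => ?_
        simp [Equiv.Perm.permMatrix, PEquiv.toMatrix_apply, eq_comm]
    _ = ∑ i, ∑ j, (∑ σ, w σ • σ.permMatrix ℝ) i j * (a i - b j) ^ 2 := by
        rw [Finset.sum_comm]
        refine Finset.sum_congr rfl fun i _ => ?_
        rw [Finset.sum_comm]
        exact Finset.sum_congr rfl fun j _ => by rw [Matrix.sum_apply, Finset.sum_mul]

end DoublyStochastic

section Eigenvalues

variable {n : ℕ}

theorem eig_monotone (A : Herm n) : Monotone (eig A) := Tuple.monotone_sort _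

theorem eig_eq_of_charpoly {A : Herm n} {f : Fin n → ℝ} (hf : Monotone f)
    (h : A.mat.charpoly = ∏ i, (X - C (f i : ℂ))) : eig A = f := by
  have hroots : (Finset.univ.val.map A.isHermitian.eigenvalues).map ((↑) : ℝ → ℂ) =
      (Finset.univ.val.map f).map (↑) := by
    have hA := A.isHermitian.roots_charpoly_eq_eigenvalues
    rw [h, roots_prod _ _ (Finset.prod_ne_zero_iff.2 fun i _ => X_sub_C_ne_zero _)] at hA
    simpa [Function.comp_def] using hA.symm
  have hperm : (List.ofFn A.isHermitian.eigenvalues).Perm (List.ofFn f) := by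
    simpa only [Fin.univ_val_map, Multiset.coe_eq_coe] using
      Multiset.map_injective Complex.ofReal_injective hroots
  exact List.ofFn_injective <| ((Equiv.Perm.ofFn_comp_perm _ _).trans hperm).eq_of_sortedLE
    (eig_monotone A).sortedLE_ofFn hf.sortedLE_ofFn

/-- The Hermitian matrix with eigenvalues `f`, the columns of the unitary `W` being eigenvectors. -/
def ofDiagonalization (W : Matrix (Fin n) (Fin n) ℂ) (f : Fin n → ℝ) : Herm n :=
  ⟨W * diagonal (fun i => (f i : ℂ)) * star W,
    IsSelfAdjoint.conjugate
      (isHermitian_diagonal_of_self_adjoint _ (funext fun i => Complex.conj_ofReal (f i))) W⟩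

theorem mat_ofDiagonalization (W : Matrix (Fin n) (Fin n) ℂ) (f : Fin n → ℝ) :
    (ofDiagonalization W f).mat = W * diagonal (fun i => (f i : ℂ)) * star W := rfl

variable {W : Matrix (Fin n) (Fin n) ℂ} (hW : W ∈ unitaryGroup (Fin n) ℂ)
include hW

theorem eig_ofDiagonalization {f : Fin n → ℝ} (hf : Monotone f) :
    eig (ofDiagonalization W f) = f := by
  refine eig_eq_of_charpoly hf ?_
  rw [mat_ofDiagonalization, charpoly_mul_comm, ← mul_assoc,
    Unitary.star_mul_self_of_mem hW, one_mul, charpoly_diagonal]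

theorem norm_sq_ofDiagonalization_sub (f g : Fin n → ℝ) :
    ‖ofDiagonalization W f - ofDiagonalization W g‖ ^ 2 = ∑ i, (f i - g i) ^ 2 := by
  have hsub : (ofDiagonalization W f - ofDiagonalization W g).mat =
      W * diagonal (fun i => ((f i - g i : ℝ) : ℂ)) * star W := by
    simp [ofDiagonalization, ← sub_mul, ← mul_sub]
  rw [← Submodule.norm_coe]
  change ‖(ofDiagonalization W f - ofDiagonalization W g).mat‖ ^ 2 = _
  rw [hsub, frobenius_norm_mul_unitary (Unitary.star_mem hW), frobenius_norm_unitary_mul hW,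
    frobenius_norm_diagonal, EuclideanSpace.norm_sq_eq]
  simp only [Complex.norm_real, Real.norm_eq_abs, sq_abs]

omit hW

theorem exists_eq_ofDiagonalization_eig (A : Herm n) :
    ∃ W ∈ unitaryGroup (Fin n) ℂ, A = ofDiagonalization W (eig A) := by
  set σ := Tuple.sort A.isHermitian.eigenvalues
  set V := A.isHermitian.eigenvectorUnitary
  have hspec := A.isHermitian.spectral_theorem
  rw [Unitary.conjStarAlgAut_apply] at hspec
  have hdiag : diagonal (fun i => (eig A i : ℂ)) =
      (diagonal (RCLike.ofReal ∘ A.isHermitian.eigenvalues)).submatrix σ σ := by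
    rw [submatrix_diagonal_equiv]
    rfl
  refine ⟨(V : Matrix _ _ ℂ).submatrix id σ, ?_, Subtype.ext ?_⟩
  · rw [mem_unitaryGroup_iff, star_eq_conjTranspose, conjTranspose_submatrix, submatrix_mul_equiv,
      ← star_eq_conjTranspose, mem_unitaryGroup_iff.1 V.2, submatrix_id_id]
  · change A.mat = (ofDiagonalization _ _).mat
    rw [mat_ofDiagonalization, hdiag, star_eq_conjTranspose, conjTranspose_submatrix,
      submatrix_mul_equiv, submatrix_mul_equiv, ← star_eq_conjTranspose, submatrix_id_id]
    exact hspec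

theorem sum_sq_eig_sub_le (A B : Herm n) : ∑ i, (eig A i - eig B i) ^ 2 ≤ ‖A - B‖ ^ 2 := by
  obtain ⟨U, hU, hA⟩ := exists_eq_ofDiagonalization_eig A
  obtain ⟨V, hV, hB⟩ := exists_eq_ofDiagonalization_eig B
  set Q := star U * V
  have hQ : Q ∈ unitaryGroup (Fin n) ℂ := mul_mem (Unitary.star_mem hU) hV
  have hconj : star U * (A.mat - B.mat) * V =
      diagonal (fun i => (eig A i : ℂ)) * Q - Q * diagonal (fun i => (eig B i : ℂ)) := by
    rw [congrArg Herm.mat hA, congrArg Herm.mat hB, mat_ofDiagonalization,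
      mat_ofDiagonalization, mul_sub, sub_mul]
    congr 1
    · simp only [Q, ← mul_assoc, Unitary.star_mul_self_of_mem hU, one_mul]
    · simp only [Q, mul_assoc, Unitary.star_mul_self_of_mem hV, mul_one]
  calc ∑ i, (eig A i - eig B i) ^ 2
      ≤ ∑ i, ∑ j, ‖Q i j‖ ^ 2 * (eig A i - eig B j) ^ 2 :=
        sum_sq_sub_le_sum_doublyStochastic ((eig_monotone A).monovary (eig_monotone B))
          (normSq_mem_doublyStochastic_of_mem_unitaryGroup hQ)
    _ = ‖star U * (A.mat - B.mat) * V‖ ^ 2 := by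
        rw [hconj, frobenius_norm_sq]
        refine Finset.sum_congr rfl fun i _ => Finset.sum_congr rfl fun j _ => ?_
        rw [Matrix.sub_apply, diagonal_mul, mul_diagonal, mul_comm (Q i j), ← sub_mul, norm_mul,
          mul_pow, ← Complex.ofReal_sub, Complex.norm_real, Real.norm_eq_abs, sq_abs, mul_comm]
    _ = ‖A - B‖ ^ 2 := by
        rw [frobenius_norm_mul_unitary hV, frobenius_norm_unitary_mul (Unitary.star_mem hU)]
        rfl

theorem abs_eig_sub_le (A B : Herm n) (i : Fin n) : |eig A i - eig B i| ≤ ‖A - B‖ :=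
  abs_le_of_sq_le_sq ((Finset.single_le_sum (f := fun i => (eig A i - eig B i) ^ 2)
    (fun _ _ => sq_nonneg _) (Finset.mem_univ i)).trans (sum_sq_eig_sub_le A B)) (norm_nonneg _)

theorem continuous_eig (i : Fin n) : Continuous fun A : Herm n => eig A i :=
  LipschitzWith.continuous (K := 1) <| LipschitzWith.of_dist_le_mul fun A B => by
    simpa only [Real.dist_eq, dist_eq_norm A, NNReal.coe_one, one_mul] using abs_eig_sub_le A B i

end Eigenvalues

/-! ### Distance from the degenerate matrices -/

section Distance

variable {n k : ℕ} {A : Herm n}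

/-- The spectral gap `λ_k < λ_{k+1}`, void for `k = n`. -/
def HasGap (k : ℕ) (A : Herm n) : Prop :=
  ∀ i j : Fin n, (i : ℕ) < k → k ≤ (j : ℕ) → eig A i < eig A j

theorem hasGap_of_mem_degenerate (hA : A ∈ degenerate n k) : HasGap k A :=
  fun i j hi hj => (hA i j hi).2 hj

theorem isOpen_setOf_hasGap : IsOpen {A : Herm n | HasGap k A} := by
  simp only [HasGap, Set.ofPred_forall]
  exact isOpen_iInter_of_finite fun i => isOpen_iInter_of_finite fun j =>
    isOpen_iInter_of_finite fun _ => isOpen_iInter_of_finite fun _ =>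
      isOpen_lt (continuous_eig i) (continuous_eig j)

theorem sum_castLE {M : Type*} [AddCommMonoid M] (hk : k ≤ n) (f : Fin n → M) :
    ∑ i : Fin k, f (Fin.castLE hk i) = ∑ i : Fin n, if (i : ℕ) < k then f i else 0 := by
  obtain ⟨m, rfl⟩ := Nat.exists_eq_add_of_le hk
  simp only [Fin.sum_univ_add, Fin.val_castAdd, Fin.is_lt, if_true, Fin.val_natAdd,
    Nat.not_lt.2 (Nat.le_add_right _ _), if_false, Finset.sum_const_zero, add_zero]
  rfl

variable (hk₁ : 1 ≤ k) (hk : k ≤ n)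

theorem sum_sq_sub_meanEig_le (a : ℝ) :
    ∑ i, (lowEig hk A i - meanEig hk A) ^ 2 ≤ ∑ i, (lowEig hk A i - a) ^ 2 := by
  simpa only [meanEig, Fintype.card_fin] using sum_sq_sub_mean_le (l := lowEig hk A) a

/-- The eigenvalues of the point of `Σ_k` nearest to `A`: the `k` lowest eigenvalues of `A` are
replaced by their mean. -/
noncomputable def collapsedEig (A : Herm n) (i : Fin n) : ℝ :=
  if (i : ℕ) < k then meanEig hk A else eig A i

theorem sum_sq_eig_sub_collapsedEig :
    ∑ i, (eig A i - collapsedEig hk A i) ^ 2 = ∑ j, (lowEig hk A j - meanEig hk A) ^ 2 := by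
  refine .trans ?_ (sum_castLE hk fun i => (eig A i - meanEig hk A) ^ 2).symm
  refine Finset.sum_congr rfl fun i _ => ?_
  rw [collapsedEig]
  split_ifs <;> simp

include hk₁

theorem sqrt_mul_stdDev :
    √k * stdDev hk A = √(∑ j, (lowEig hk A j - meanEig hk A) ^ 2) := by
  have hk_pos : (0 : ℝ) < k := by exact_mod_cast hk₁
  rw [stdDev, ← Real.sqrt_mul hk_pos.le, mul_div_cancel₀ _ hk_pos.ne']

theorem meanEig_lt {a : ℝ} (h : ∀ j, lowEig hk A j < a) : meanEig hk A < a := by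
  have hk_pos : (0 : ℝ) < k := by exact_mod_cast hk₁
  rw [meanEig, div_lt_iff₀ hk_pos]
  calc ∑ j, lowEig hk A j < ∑ _j : Fin k, a :=
        Finset.sum_lt_sum_of_nonempty ⟨⟨0, hk₁⟩, Finset.mem_univ _⟩ fun j _ => h j
    _ = a * k := by simp [mul_comm]

theorem HasGap.meanEig_lt_eig (hgap : HasGap k A) {j : Fin n} (hj : k ≤ (j : ℕ)) :
    meanEig hk A < eig A j :=
  meanEig_lt hk₁ hk fun i => hgap _ _ i.2 hj

theorem HasGap.collapsedEig_monotone (hgap : HasGap k A) : Monotone (collapsedEig hk A) := by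
  intro i j hij
  have : (i : ℕ) ≤ j := hij
  rw [collapsedEig, collapsedEig]
  split_ifs with hi hj hj
  · exact le_rfl
  · exact (hgap.meanEig_lt_eig hk₁ hk (not_lt.1 hj)).le
  · omega
  · exact eig_monotone A hij

theorem HasGap.ofDiagonalization_collapsedEig_mem (hgap : HasGap k A)
    {W : Matrix (Fin n) (Fin n) ℂ} (hW : W ∈ unitaryGroup (Fin n) ℂ) :
    ofDiagonalization W (collapsedEig hk A) ∈ degenerate n k := by
  intro i j hi
  rw [eig_ofDiagonalization hW (hgap.collapsedEig_monotone hk₁ hk)]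
  refine ⟨fun hj => by simp only [collapsedEig, hi, hj, if_true], fun hj => ?_⟩
  simpa only [collapsedEig, hi, hj.not_gt, if_true, if_false] using hgap.meanEig_lt_eig hk₁ hk hj

theorem sqrt_sum_sq_sub_meanEig_le_norm_sub {B : Herm n} (hB : B ∈ degenerate n k) :
    √(∑ j, (lowEig hk A j - meanEig hk A) ^ 2) ≤ ‖A - B‖ := by
  set i₀ : Fin n := Fin.castLE hk ⟨0, hk₁⟩
  rw [Real.sqrt_le_left (norm_nonneg _)]
  calc ∑ i, (lowEig hk A i - meanEig hk A) ^ 2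
      ≤ ∑ i, (lowEig hk A i - eig B i₀) ^ 2 := sum_sq_sub_meanEig_le hk _
    _ = ∑ i : Fin k, (eig A (Fin.castLE hk i) - eig B (Fin.castLE hk i)) ^ 2 :=
        Finset.sum_congr rfl fun i _ => by
          rw [(hB i₀ (Fin.castLE hk i) hk₁).1 i.2, lowEig]
    _ = ∑ i : Fin n, if (i : ℕ) < k then (eig A i - eig B i) ^ 2 else 0 :=
        sum_castLE hk fun i => (eig A i - eig B i) ^ 2
    _ ≤ ∑ i, (eig A i - eig B i) ^ 2 := Finset.sum_le_sum fun i _ => by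
        split_ifs
        exacts [le_rfl, sq_nonneg _]
    _ ≤ ‖A - B‖ ^ 2 := sum_sq_eig_sub_le A B

theorem HasGap.infDist_degenerate (hgap : HasGap k A) :
    Metric.infDist A (degenerate n k) = √k * stdDev hk A := by
  rw [sqrt_mul_stdDev hk₁]
  obtain ⟨W, hW, hA⟩ := exists_eq_ofDiagonalization_eig A
  have hmem := hgap.ofDiagonalization_collapsedEig_mem hk₁ hk hW
  apply le_antisymm
  · refine (Metric.infDist_le_dist_of_mem hmem).trans_eq ?_
    rw [dist_eq_norm, ← Real.sqrt_sq (norm_nonneg _), ← sum_sq_eig_sub_collapsedEig,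
      ← norm_sq_ofDiagonalization_sub hW, ← hA]
  · refine (Metric.le_infDist ⟨_, hmem⟩).2 fun B hB => ?_
    rw [dist_eq_norm]
    exact sqrt_sum_sq_sub_meanEig_le_norm_sub hk₁ hk hB

end Distance

/-! ### The effective Hamiltonian and the lowest eigenvalues -/

section StarProjection

variable {𝕜 ι : Type*} [RCLike 𝕜] [Fintype ι] [DecidableEq ι] {P Q U V : Matrix ι ι 𝕜}

open scoped ComplexOrder in
theorem commute_of_isStarProjection (hP : IsStarProjection P) (hQ : Q ∈ unitaryGroup ι 𝕜)
    (h : P * Q * P = Q * P) : Commute P Q := by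
  have hPP : P * P = P := hP.isIdempotentElem
  have hPs : Pᴴ = P := hP.isSelfAdjoint
  have hQs : Qᴴ * Q = 1 := Unitary.star_mul_self_of_mem hQ
  have htrace : trace ((P * Q - P * Q * P)ᴴ * (P * Q - P * Q * P)) = 0 := by
    have hexpand : (P * Q - P * Q * P)ᴴ * (P * Q - P * Q * P) =
        (1 - P) * (Qᴴ * P * Q * (1 - P)) := by
      simp only [conjTranspose_sub, conjTranspose_mul, hPs]
      linear_combination (norm := noncomm_ring) (1 - P) * Qᴴ * hPP * Q * (1 - P)
    have hidem : (1 - P) * (1 - P) = 1 - P := by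
      linear_combination (norm := noncomm_ring) hPP
    rw [hexpand, trace_mul_comm, mul_assoc, hidem, mul_sub, mul_one, mul_assoc, mul_assoc,
      h, ← mul_assoc Qᴴ Q, hQs, one_mul, trace_sub, trace_mul_comm, mul_assoc,
      mul_eq_one_comm.1 hQs, mul_one, sub_self]
  have hzero := trace_conjTranspose_mul_self_eq_zero_iff.1 htrace
  exact (sub_eq_zero.1 hzero).trans h

/-- Two orthonormal bases whose first parts span comparable subspaces differ by a block diagonal
unitary. -/
theorem commute_star_mul_of_range_le (hP : IsStarProjection P) (hU : U ∈ unitaryGroup ι 𝕜)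
    (hV : V ∈ unitaryGroup ι 𝕜)
    (h : LinearMap.range (V * P).mulVecLin ≤ LinearMap.range (U * P).mulVecLin) :
    Commute P (star U * V) := by
  refine commute_of_isStarProjection hP (mul_mem (Unitary.star_mem hU) hV)
    (ext_of_mulVec_single fun i => ?_)
  obtain ⟨y, hy⟩ := h ⟨Pi.single i 1, rfl⟩
  have hstar : (star U * V * P) *ᵥ Pi.single i 1 = P *ᵥ y := by
    rw [mul_assoc, ← mulVec_mulVec, ← mulVecLin_apply (V * P), ← hy, mulVecLin_apply,
      mulVec_mulVec, ← mul_assoc, Unitary.star_mul_self_of_mem hU, one_mul]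
  rw [mul_assoc, ← mulVec_mulVec, hstar, mulVec_mulVec, hP.isIdempotentElem.eq]

end StarProjection

section BlockOne

variable {n k : ℕ}

theorem blockOne_mul_apply (X : Matrix (Fin n) (Fin n) ℂ) (i j : Fin n) :
    (blockOne n k * X) i j = if (i : ℕ) < k then X i j else 0 := by
  simp [blockOne, diagonal_mul]

theorem mul_blockOne_apply (X : Matrix (Fin n) (Fin n) ℂ) (i j : Fin n) :
    (X * blockOne n k) i j = if (j : ℕ) < k then X i j else 0 := by
  simp [blockOne, mul_diagonal]

theorem isStarProjection_blockOne : IsStarProjection (blockOne n k) where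
  isIdempotentElem := by
    rw [IsIdempotentElem, blockOne, diagonal_mul_diagonal]
    congr 1
    ext i
    split_ifs <;> simp
  isSelfAdjoint := isHermitian_diagonal_of_self_adjoint _ <| funext fun i => by
    simp only [Pi.star_apply, apply_ite star, star_one, star_zero]

theorem span_col_castLE (hk : k ≤ n) (V : Matrix (Fin n) (Fin n) ℂ) :
    Submodule.span ℂ (Set.range fun j : Fin k => V.col (Fin.castLE hk j)) =
      LinearMap.range (V * blockOne n k).mulVecLin := by
  have hcol (j : Fin n) : (V * blockOne n k).col j = if (j : ℕ) < k then V.col j else 0 := by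
    ext i
    rw [col_apply, mul_blockOne_apply]
    split_ifs <;> rfl
  rw [range_mulVecLin]
  refine le_antisymm (Submodule.span_le.2 ?_) (Submodule.span_le.2 ?_)
  · rintro _ ⟨j, rfl⟩
    exact Submodule.subset_span ⟨Fin.castLE hk j, by simp [hcol]⟩
  · rintro _ ⟨j, rfl⟩
    rw [hcol]
    split_ifs with hj
    · exact Submodule.subset_span ⟨⟨j, hj⟩, rfl⟩
    · exact Submodule.zero_mem _

theorem ofDiagonalization_mulVec_col {W : Matrix (Fin n) (Fin n) ℂ}
    (hW : W ∈ unitaryGroup (Fin n) ℂ) (f : Fin n → ℝ) (j : Fin n) :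
    (ofDiagonalization W f).mat *ᵥ W.col j = (f j : ℂ) • W.col j := by
  have hcomm : (ofDiagonalization W f).mat * W = W * diagonal (fun i => (f i : ℂ)) := by
    rw [mat_ofDiagonalization, mul_assoc, Unitary.star_mul_self_of_mem hW, mul_one]
  ext i
  have hij := congrArg (fun A : Matrix (Fin n) (Fin n) ℂ => A i j) hcomm
  simp only [mul_diagonal] at hij
  rw [Pi.smul_apply, smul_eq_mul, mul_comm, col_apply, ← hij]
  rfl

theorem span_col_le_iSup_eigenspace (hk : k ≤ n) {W : Matrix (Fin n) (Fin n) ℂ}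
    (hW : W ∈ unitaryGroup (Fin n) ℂ) (f : Fin n → ℝ) :
    Submodule.span ℂ (Set.range fun j : Fin k => W.col (Fin.castLE hk j)) ≤
      ⨆ j : Fin k, Module.End.eigenspace (toLin' (ofDiagonalization W f).mat)
        (f (Fin.castLE hk j) : ℂ) := by
  rw [Submodule.span_le]
  rintro _ ⟨j, rfl⟩
  refine Submodule.mem_iSup_of_mem j ?_
  rw [Module.End.mem_eigenspace_iff, toLin'_apply, ofDiagonalization_mulVec_col hW]

end BlockOne

section EffectiveHamiltonian

variable {n k : ℕ} {H₀ H : Herm n}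

theorem IsBasePoint.eq_ofDiagonalization (h : IsBasePoint k H₀) :
    H₀ = ofDiagonalization 1 (eig H₀) := by
  have hdiag : H₀ = ofDiagonalization 1 fun i => (H₀.mat i i).re := by
    refine Subtype.ext ?_
    change H₀.mat = (ofDiagonalization _ _).mat
    rw [mat_ofDiagonalization, one_mul, star_one, mul_one, ← h.diag.diagonal_diag]
    congr 1
    ext i
    simpa using (Complex.conj_eq_iff_re.1 (H₀.isHermitian.apply i i)).symm
  conv_rhs => rw [congrArg eig hdiag, eig_ofDiagonalization (one_mem _) h.mono]
  exact hdiag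

theorem IsBasePoint.mat_eq_diagonal (h : IsBasePoint k H₀) :
    H₀.mat = diagonal fun i => (eig H₀ i : ℂ) := by
  simpa only [mat_ofDiagonalization, one_mul, star_one, mul_one] using
    congrArg Herm.mat h.eq_ofDiagonalization

theorem IsBasePoint.exists_blockOne_mul (h : IsBasePoint k H₀) :
    ∃ μ : ℝ, blockOne n k * H₀.mat = (μ : ℂ) • blockOne n k := by
  have hconst : ∃ μ, ∀ i : Fin n, (i : ℕ) < k → eig H₀ i = μ := by
    by_cases hi : ∃ i : Fin n, (i : ℕ) < k
    · exact ⟨_, fun j hj => (h.mem j hi.choose hj).1 hi.choose_spec⟩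
    · exact ⟨0, fun i hik => (hi ⟨i, hik⟩).elim⟩
  obtain ⟨μ, hμ⟩ := hconst
  refine ⟨μ, ?_⟩
  rw [h.mat_eq_diagonal, blockOne, diagonal_mul_diagonal, ← diagonal_smul]
  congr 1
  ext i
  by_cases hi : (i : ℕ) < k
  · simp [hi, hμ i hi]
  · simp [hi]

namespace SWData

variable (p : SWData n k)

/-- The block diagonal Hermitian matrix `H₀ + B + T + H_eff` of a decomposition. -/
abbrev blockMat (H₀ : Herm n) : Matrix (Fin n) (Fin n) ℂ := H₀.mat + p.B + p.T + p.eff.1.mat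

theorem exp_mem_unitary : NormedSpace.exp (Complex.I • p.S) ∈ unitaryGroup (Fin n) ℂ :=
  NormedSpace.exp_mem_unitary_of_mem_skewAdjoint
    (IsSelfAdjoint.smul_mem_skewAdjoint Complex.conj_I p.1.1.2)

theorem star_exp :
    star (NormedSpace.exp (Complex.I • p.S)) = NormedSpace.exp (-(Complex.I • p.S)) := by
  rw [NormedSpace.star_exp,
    skewAdjoint.mem_iff.1 (IsSelfAdjoint.smul_mem_skewAdjoint Complex.conj_I p.1.1.2)]

theorem blockOne_mul_B : blockOne n k * p.B = 0 := by
  ext i j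
  rw [blockOne_mul_apply]
  split_ifs with hi
  · exact p.2.1.2 i j (Or.inl hi)
  · rfl

theorem blockOne_mul_eff : blockOne n k * p.eff.1.mat = p.eff.1.mat := by
  ext i j
  rw [blockOne_mul_apply]
  split_ifs with hi
  · rfl
  · exact (p.eff.2.1 i j (Or.inl (not_lt.1 hi))).symm

theorem exists_blockOne_mul_blockMat (hH₀ : IsBasePoint k H₀) :
    ∃ μ : ℝ, blockOne n k * p.blockMat H₀ = (μ : ℂ) • blockOne n k + p.eff.1.mat := by
  obtain ⟨μ, hμ⟩ := hH₀.exists_blockOne_mul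
  refine ⟨μ + p.2.2.1, ?_⟩
  rw [blockMat, mul_add, mul_add, mul_add, p.blockOne_mul_B, p.blockOne_mul_eff, hμ, T,
    Matrix.mul_smul, isStarProjection_blockOne.isIdempotentElem.eq, add_zero, ← add_smul,
    Complex.ofReal_add]

end SWData

namespace IsSWDecomposition

variable {hk : k ≤ n} {p : SWData n k}

/-- The block diagonal matrix is diagonalized by a block diagonal unitary, which therefore
diagonalizes its upper left block `μ + H_eff`. -/
theorem exists_eff_mul_unitary_eq (hH₀ : IsBasePoint k H₀) (h : IsSWDecomposition hk H₀ H p) :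
    ∃ μ : ℝ, ∃ Q ∈ unitaryGroup (Fin n) ℂ, p.eff.1.mat * Q =
      Q * diagonal fun i : Fin n => if (i : ℕ) < k then ((eig H i - μ : ℝ) : ℂ) else 0 := by
  obtain ⟨μ, hμ⟩ := p.exists_blockOne_mul_blockMat hH₀
  obtain ⟨V, hV, hHV⟩ := exists_eq_ofDiagonalization_eig H
  set U := NormedSpace.exp (Complex.I • p.S)
  have hU : U ∈ unitaryGroup (Fin n) ℂ := p.exp_mem_unitary
  have hcomm : Commute (blockOne n k) (star U * V) := by
    refine commute_star_mul_of_range_le isStarProjection_blockOne hU hV ?_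
    rw [← span_col_castLE hk, ← span_col_castLE hk, h.lowest]
    simpa only [lowEig, ← hHV] using span_col_le_iSup_eigenspace hk hV (eig H)
  have hdiag : p.blockMat H₀ * (star U * V) =
      star U * V * diagonal (fun i => (eig H i : ℂ)) := by
    have heq : U * p.blockMat H₀ * star U = V * diagonal (fun i => (eig H i : ℂ)) * star V := by
      rw [p.star_exp, ← h.eq]
      exact congrArg Herm.mat hHV
    linear_combination (norm := noncomm_ring) star U * heq * V
      - Unitary.star_mul_self_of_mem hU * p.blockMat H₀ * star U * V
      + star U * V * diagonal (fun i => (eig H i : ℂ)) * Unitary.star_mul_self_of_mem hV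
  refine ⟨μ, star U * V, mul_mem (Unitary.star_mem hU) hV, ?_⟩
  calc p.eff.1.mat * (star U * V)
      = blockOne n k * (p.blockMat H₀ * (star U * V)) -
          (μ : ℂ) • (blockOne n k * (star U * V)) := by
        rw [← mul_assoc (blockOne n k), hμ, add_mul, Matrix.smul_mul, add_sub_cancel_left]
    _ = star U * V *
          (blockOne n k * diagonal (fun i => (eig H i : ℂ)) - (μ : ℂ) • blockOne n k) := by
        rw [hdiag, ← mul_assoc, hcomm.eq, mul_assoc, mul_sub, Matrix.mul_smul]
    _ = _ := by
        rw [blockOne, diagonal_mul_diagonal, ← diagonal_smul, diagonal_sub]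
        congr 2
        ext i
        split_ifs with hi <;> simp [hi]

theorem norm_eff (hk₁ : 1 ≤ k) (hH₀ : IsBasePoint k H₀) (h : IsSWDecomposition hk H₀ H p) :
    ‖p.eff‖ = √k * stdDev hk H := by
  obtain ⟨μ, Q, hQ, hEQ⟩ := h.exists_eff_mul_unitary_eq hH₀
  have hmean : meanEig hk H = μ := by
    have htrace : ∑ j : Fin k, ((eig H (Fin.castLE hk j) - μ : ℝ) : ℂ) = 0 := by
      rw [sum_castLE hk fun i => ((eig H i - μ : ℝ) : ℂ), ← trace_diagonal]
      refine .trans ?_ p.eff.2.2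
      rw [← mul_one p.eff.1.mat, ← Unitary.mul_star_self_of_mem hQ, ← mul_assoc, hEQ,
        trace_mul_comm, ← mul_assoc, Unitary.star_mul_self_of_mem hQ, one_mul]
    have hsum : ∑ j, lowEig hk H j - k * μ = 0 := by
      simpa [Finset.sum_sub_distrib, lowEig] using
        (show ∑ j : Fin k, (eig H (Fin.castLE hk j) - μ) = 0 by exact_mod_cast htrace)
    rw [meanEig, div_eq_iff (by exact_mod_cast (Nat.one_le_iff_ne_zero.1 hk₁))]
    linarith
  have hnorm : ‖p.eff‖ ^ 2 = ∑ j, (lowEig hk H j - meanEig hk H) ^ 2 := by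
    change ‖p.eff.1.mat‖ ^ 2 = _
    rw [← frobenius_norm_mul_unitary hQ, hEQ, frobenius_norm_unitary_mul hQ,
      frobenius_norm_diagonal, EuclideanSpace.norm_sq_eq, hmean]
    refine .trans ?_ (sum_castLE hk fun i => (eig H i - μ) ^ 2).symm
    refine Finset.sum_congr rfl fun i _ => ?_
    simp only [apply_ite norm, ite_pow, Complex.norm_real, Real.norm_eq_abs, sq_abs, norm_zero,
      ne_eq, OfNat.ofNat_ne_zero, not_false_eq_true, zero_pow]
  rw [sqrt_mul_stdDev hk₁, ← hnorm]
  exact (Real.sqrt_sq (norm_nonneg p.eff)).symm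

end IsSWDecomposition

end EffectiveHamiltonian

/-! ### Block diagonal matrices -/

section BlockDiagonal

variable {n k m : ℕ}

/-- The matrix of size `k + m` with diagonal blocks `A` and `D`, indexed by `Fin (k + m)`. -/
noncomputable def fromDiagBlocks (A : Matrix (Fin k) (Fin k) ℂ) (D : Matrix (Fin m) (Fin m) ℂ) :
    Matrix (Fin (k + m)) (Fin (k + m)) ℂ :=
  reindex finSumFinEquiv finSumFinEquiv (fromBlocks A 0 0 D)

theorem fromDiagBlocks_mul (A A' : Matrix (Fin k) (Fin k) ℂ) (D D' : Matrix (Fin m) (Fin m) ℂ) :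
    fromDiagBlocks A D * fromDiagBlocks A' D' = fromDiagBlocks (A * A') (D * D') := by
  simp [fromDiagBlocks, fromBlocks_multiply]

theorem star_fromDiagBlocks (A : Matrix (Fin k) (Fin k) ℂ) (D : Matrix (Fin m) (Fin m) ℂ) :
    star (fromDiagBlocks A D) = fromDiagBlocks (star A) (star D) := by
  simp [fromDiagBlocks, star_eq_conjTranspose, fromBlocks_conjTranspose]

theorem fromDiagBlocks_one :
    fromDiagBlocks (1 : Matrix (Fin k) (Fin k) ℂ) (1 : Matrix (Fin m) (Fin m) ℂ) = 1 := by
  simp [fromDiagBlocks]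

theorem fromDiagBlocks_mem_unitaryGroup {A : Matrix (Fin k) (Fin k) ℂ}
    {D : Matrix (Fin m) (Fin m) ℂ} (hA : A ∈ unitaryGroup (Fin k) ℂ)
    (hD : D ∈ unitaryGroup (Fin m) ℂ) : fromDiagBlocks A D ∈ unitaryGroup (Fin (k + m)) ℂ := by
  rw [mem_unitaryGroup_iff, star_fromDiagBlocks, fromDiagBlocks_mul, mem_unitaryGroup_iff.1 hA,
    mem_unitaryGroup_iff.1 hD, fromDiagBlocks_one]

theorem diagonal_append {α : Type*} (a : Fin k → α) (b : Fin m → α) (φ : α → ℂ) :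
    diagonal (fun i => φ (Fin.append a b i)) =
      fromDiagBlocks (diagonal fun i => φ (a i)) (diagonal fun i => φ (b i)) := by
  rw [fromDiagBlocks, fromBlocks_diagonal, reindex_apply, submatrix_diagonal_equiv]
  congr 1
  ext i
  induction i using Fin.addCases <;> simp

theorem blockOne_eq_fromDiagBlocks : blockOne (k + m) k = fromDiagBlocks 1 0 := by
  rw [← diagonal_one, ← diagonal_zero, fromDiagBlocks, fromBlocks_diagonal, reindex_apply,
    submatrix_diagonal_equiv, blockOne]
  congr 1
  ext i
  induction i using Fin.addCases <;> simp

/-- The real linear map taking a Hermitian matrix to its submatrix with indices in the range of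
`e`. -/
def Herm.submatrix (e : Fin m → Fin n) : Herm n →ₗ[ℝ] Herm m where
  toFun X := ⟨X.mat.submatrix e e, X.isHermitian.submatrix e⟩
  map_add' _ _ := rfl
  map_smul' _ _ := rfl

theorem Herm.mat_submatrix (e : Fin m → Fin n) (X : Herm n) :
    (Herm.submatrix e X).mat = X.mat.submatrix e e := rfl

theorem eq_fromDiagBlocks {X : Herm (k + m)}
    (hX : ∀ i j, X.mat (Fin.castAdd m i) (Fin.natAdd k j) = 0) :
    X.mat = fromDiagBlocks (Herm.submatrix (Fin.castAdd m) X).mat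
      (Herm.submatrix (Fin.natAdd k) X).mat := by
  have hX' (i j) : X.mat (Fin.natAdd k i) (Fin.castAdd m j) = 0 := by
    rw [← X.isHermitian.apply, hX, star_zero]
  ext i j
  induction i using Fin.addCases <;> induction j using Fin.addCases <;>
    simp [fromDiagBlocks, hX, hX', Herm.mat_submatrix]

theorem exists_eq_ofDiagonalization_append {X : Herm (k + m)}
    (hX : ∀ i j, X.mat (Fin.castAdd m i) (Fin.natAdd k j) = 0) :
    ∃ W ∈ unitaryGroup (Fin (k + m)) ℂ, Commute (blockOne (k + m) k) W ∧
      X = ofDiagonalization W (Fin.append (eig (Herm.submatrix (Fin.castAdd m) X))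
        (eig (Herm.submatrix (Fin.natAdd k) X))) := by
  obtain ⟨W₁, hW₁, h₁⟩ := exists_eq_ofDiagonalization_eig (Herm.submatrix (Fin.castAdd m) X)
  obtain ⟨W₂, hW₂, h₂⟩ := exists_eq_ofDiagonalization_eig (Herm.submatrix (Fin.natAdd k) X)
  refine ⟨fromDiagBlocks W₁ W₂, fromDiagBlocks_mem_unitaryGroup hW₁ hW₂, ?_, Subtype.ext ?_⟩
  · rw [Commute, SemiconjBy, blockOne_eq_fromDiagBlocks, fromDiagBlocks_mul, fromDiagBlocks_mul,
      mul_one, one_mul, mul_zero, zero_mul]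
  · change X.mat = (ofDiagonalization _ _).mat
    rw [mat_ofDiagonalization, diagonal_append, star_fromDiagBlocks, fromDiagBlocks_mul,
      fromDiagBlocks_mul, eq_fromDiagBlocks hX]
    exact congrArg₂ fromDiagBlocks (congrArg Herm.mat h₁) (congrArg Herm.mat h₂)

theorem monotone_append {α : Type*} [Preorder α] {a : Fin k → α} {b : Fin m → α} (ha : Monotone a)
    (hb : Monotone b) (h : ∀ i j, a i ≤ b j) : Monotone (Fin.append a b) := by
  intro i j hij
  induction i using Fin.addCases with
  | left i =>
    induction j using Fin.addCases with
    | left j => simpa only [Fin.append_left] using ha (show (i : ℕ) ≤ j from hij)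
    | right j => simpa only [Fin.append_left, Fin.append_right] using h i j
  | right i =>
    induction j using Fin.addCases with
    | left j =>
      simp only [Fin.le_def, Fin.val_natAdd, Fin.val_castAdd] at hij
      omega
    | right j => simpa only [Fin.append_right] using hb ((Fin.natAdd_le_natAdd_iff k).1 hij)

theorem eig_of_blockDiagonal {X : Herm (k + m)}
    (hX : ∀ i j, X.mat (Fin.castAdd m i) (Fin.natAdd k j) = 0)
    (hgap : ∀ i j, eig (Herm.submatrix (Fin.castAdd m) X) i ≤
      eig (Herm.submatrix (Fin.natAdd k) X) j) :
    eig X = Fin.append (eig (Herm.submatrix (Fin.castAdd m) X))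
      (eig (Herm.submatrix (Fin.natAdd k) X)) := by
  obtain ⟨W, hW, -, hXW⟩ := exists_eq_ofDiagonalization_append hX
  conv_lhs => rw [hXW]
  exact eig_ofDiagonalization hW (monotone_append (eig_monotone _) (eig_monotone _) hgap)

end BlockDiagonal

section LowestEigenspaces

variable {n k : ℕ} (hk : k ≤ n) {U W : Matrix (Fin n) (Fin n) ℂ}

theorem span_col_mul_unitary (hW : W ∈ unitaryGroup (Fin n) ℂ) (hc : Commute (blockOne n k) W) :
    Submodule.span ℂ (Set.range fun j : Fin k => (U * W).col (Fin.castLE hk j)) =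
      Submodule.span ℂ (Set.range fun j : Fin k => U.col (Fin.castLE hk j)) := by
  rw [span_col_castLE, span_col_castLE, mul_assoc, ← hc.eq, ← mul_assoc, mulVecLin_mul]
  refine LinearMap.range_comp_of_range_eq_top _ (LinearMap.range_eq_top.2 fun x => ?_)
  refine ⟨star W *ᵥ x, ?_⟩
  rw [mulVecLin_apply, mulVec_mulVec, Unitary.mul_star_self_of_mem hW, one_mulVec]

theorem eigenspace_le_span_col (hU : U ∈ unitaryGroup (Fin n) ℂ) {f : Fin n → ℝ} {a : ℝ}
    (ha : ∀ i : Fin n, k ≤ (i : ℕ) → a ≠ f i) :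
    Module.End.eigenspace (toLin' (ofDiagonalization U f).mat) (a : ℂ) ≤
      Submodule.span ℂ (Set.range fun j : Fin k => U.col (Fin.castLE hk j)) := by
  intro v hv
  rw [Module.End.mem_eigenspace_iff, toLin'_apply, mat_ofDiagonalization] at hv
  have hw : diagonal (fun i => (f i : ℂ)) *ᵥ (star U *ᵥ v) = (a : ℂ) • (star U *ᵥ v) := by
    rw [← mulVec_smul, ← hv, mulVec_mulVec, mulVec_mulVec, mul_assoc U, ← mul_assoc,
      Unitary.star_mul_self_of_mem hU, one_mul]
  have hzero (i : Fin n) (hi : k ≤ (i : ℕ)) : (star U *ᵥ v) i = 0 := by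
    have hwi := congrFun hw i
    rw [mulVec_diagonal, Pi.smul_apply, smul_eq_mul] at hwi
    by_contra hne
    exact ha i hi (Complex.ofReal_injective (mul_right_cancel₀ hne hwi).symm)
  have hblock : blockOne n k *ᵥ (star U *ᵥ v) = star U *ᵥ v := by
    ext i
    rw [blockOne, mulVec_diagonal]
    split_ifs with hi
    · rw [one_mul]
    · rw [zero_mul, hzero i (not_lt.1 hi)]
  rw [span_col_castLE]
  refine ⟨star U *ᵥ v, ?_⟩
  rw [mulVecLin_apply, ← mulVec_mulVec, hblock, mulVec_mulVec, Unitary.mul_star_self_of_mem hU,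
    one_mulVec]

theorem span_col_eq_iSup_eigenspace (hU : U ∈ unitaryGroup (Fin n) ℂ) {f : Fin n → ℝ}
    (hgap : ∀ i j : Fin n, (i : ℕ) < k → k ≤ (j : ℕ) → f i < f j) :
    Submodule.span ℂ (Set.range fun j : Fin k => U.col (Fin.castLE hk j)) =
      ⨆ j : Fin k, Module.End.eigenspace (toLin' (ofDiagonalization U f).mat)
        (f (Fin.castLE hk j) : ℂ) :=
  le_antisymm (span_col_le_iSup_eigenspace hk hU f) <| iSup_le fun j =>
    eigenspace_le_span_col hk hU fun _ hi => (hgap _ _ j.2 hi).ne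

end LowestEigenspaces

/-! ### Local inversion of the decomposition map -/

section ExpConj

variable {E A : Type*} [NormedAddCommGroup E] [NormedSpace ℝ E] [NormedRing A] [NormedAlgebra ℝ A]

theorem analyticAt_exp_conj [CompleteSpace A] (L N : E →L[ℝ] A) (a : A) (x : E) :
    AnalyticAt ℝ (fun p => NormedSpace.exp (L p) * (a + N p) * NormedSpace.exp (-L p)) x :=
  (((NormedSpace.exp_analytic (𝕂 := ℝ) _).fun_comp (L.analyticAt x)).fun_mul
    (analyticAt_const.fun_add (N.analyticAt x))).fun_mul
    ((NormedSpace.exp_analytic (𝕂 := ℝ) _).fun_comp (L.analyticAt x).fun_neg)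

theorem hasStrictFDerivAt_exp_conj [CompleteSpace A] (L N : E →L[ℝ] A) (a : A) :
    HasStrictFDerivAt (fun p => NormedSpace.exp (L p) * (a + N p) * NormedSpace.exp (-L p))
      ((ContinuousLinearMap.mul ℝ A).flip a ∘L L - ContinuousLinearMap.mul ℝ A a ∘L L + N) 0 := by
  have hexp (M : E →L[ℝ] A) : HasStrictFDerivAt (fun p => NormedSpace.exp (M p)) M 0 := by
    refine HasStrictFDerivAt.comp (0 : E) (f := M) (g' := (1 : A →L[ℝ] A)) ?_ M.hasStrictFDerivAt
    simpa only [map_zero] using hasStrictFDerivAt_exp_zero (𝕂 := ℝ) (𝔸 := A)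
  refine (((hexp L).mul' (N.hasStrictFDerivAt.const_add a)).mul' (hexp (-L))).congr_fderiv ?_
  ext p
  simp [NormedSpace.exp_zero]
  abel

/-- The inverse function theorem, with the derivative at `0` of `p ↦ e^{L p} (a + N p) e^{-L p}`. -/
theorem exists_openPartialHomeomorph_exp_conj [FiniteDimensional ℝ E] [FiniteDimensional ℝ A]
    {K : Submodule ℝ A} (L N : E →ₗ[ℝ] A) {a : A} {f : E → K}
    (hf : ∀ p, (f p : A) = NormedSpace.exp (L p) * (a + N p) * NormedSpace.exp (-L p))
    (D : E ≃ₗ[ℝ] K) (hD : ∀ p, (D p : A) = L p * a - a * L p + N p) :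
    ∃ Φ : OpenPartialHomeomorph E K, 0 ∈ Φ.source ∧ ⇑Φ = f ∧ AnalyticAt ℝ Φ.symm (f 0) := by
  have := FiniteDimensional.complete ℝ E
  have := FiniteDimensional.complete ℝ A
  obtain ⟨ρ, hρ⟩ := K.subtype.exists_leftInverse_of_injective K.ker_subtype
  replace hρ (y : K) : ρ y = y := LinearMap.congr_fun hρ y
  have hfρ : f = fun p => ρ.toContinuousLinearMap (NormedSpace.exp (L.toContinuousLinearMap p) *
      (a + N.toContinuousLinearMap p) * NormedSpace.exp (-L.toContinuousLinearMap p)) :=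
    funext fun p => (hρ (f p)).symm.trans (congrArg ρ (hf p))
  have hderiv : HasStrictFDerivAt f (D.toContinuousLinearEquiv : E →L[ℝ] K) 0 := by
    rw [hfρ]
    refine (ρ.toContinuousLinearMap.hasStrictFDerivAt.comp (0 : E)
      (hasStrictFDerivAt_exp_conj _ _ a)).congr_fderiv ?_
    ext1 p
    exact (congrArg ρ (hD p)).symm.trans (hρ (D p))
  have hanalytic : AnalyticAt ℝ f 0 := by
    rw [hfρ]
    exact (ρ.toContinuousLinearMap.analyticAt _).fun_comp (analyticAt_exp_conj _ _ a 0)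
  exact ⟨hderiv.toOpenPartialHomeomorph f, hderiv.mem_toOpenPartialHomeomorph_source, rfl,
    (hderiv.toOpenPartialHomeomorph f).analyticAt_symm'
      hderiv.mem_toOpenPartialHomeomorph_source hanalytic hderiv.hasFDerivAt.fderiv⟩

end ExpConj

section DecompositionMap

variable {n k : ℕ}

/-- Conjugation `X ↦ U X U*` as a real linear map on Hermitian matrices. -/
def Herm.conj (U : Matrix (Fin n) (Fin n) ℂ) : Herm n →ₗ[ℝ] Herm n where
  toFun X := ⟨U * X.mat * star U, X.2.conjugate U⟩
  map_add' X Y := Subtype.ext <| by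
    change U * (X.mat + Y.mat) * star U = U * X.mat * star U + U * Y.mat * star U
    rw [mul_add, add_mul]
  map_smul' c X := Subtype.ext <| by
    change U * (c • X.mat) * star U = c • (U * X.mat * star U)
    rw [Matrix.mul_smul, Matrix.smul_mul]

theorem Herm.mat_conj (U : Matrix (Fin n) (Fin n) ℂ) (X : Herm n) :
    (Herm.conj U X).mat = U * X.mat * star U := rfl

theorem conj_ofDiagonalization (U W : Matrix (Fin n) (Fin n) ℂ) (f : Fin n → ℝ) :
    Herm.conj U (ofDiagonalization W f) = ofDiagonalization (U * W) f := by
  refine Subtype.ext ?_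
  change (Herm.conj _ _).mat = (ofDiagonalization _ _).mat
  rw [Herm.mat_conj, mat_ofDiagonalization, mat_ofDiagonalization, star_mul]
  simp only [mul_assoc]

theorem eig_conj {U : Matrix (Fin n) (Fin n) ℂ} (hU : U ∈ unitaryGroup (Fin n) ℂ) (X : Herm n) :
    eig (Herm.conj U X) = eig X := by
  obtain ⟨W, hW, hX⟩ := exists_eq_ofDiagonalization_eig X
  conv_lhs => rw [hX, conj_ofDiagonalization]
  exact eig_ofDiagonalization (mul_mem hU hW) (eig_monotone X)

theorem conj_blockOne_apply (X : Herm n) (i j : Fin n) : (Herm.conj (blockOne n k) X).mat i j =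
    if (i : ℕ) < k ∧ (j : ℕ) < k then X.mat i j else 0 := by
  rw [Herm.mat_conj, isStarProjection_blockOne.isSelfAdjoint, mul_blockOne_apply,
    blockOne_mul_apply, ← ite_and]
  simp only [and_comm]

theorem conj_one_sub_blockOne_apply (X : Herm n) (i j : Fin n) :
    (Herm.conj (1 - blockOne n k) X).mat i j =
      if (i : ℕ) < k ∨ (j : ℕ) < k then 0 else X.mat i j := by
  rw [Herm.mat_conj, star_sub, star_one, isStarProjection_blockOne.isSelfAdjoint, mul_sub, mul_one,
    Matrix.sub_apply, mul_blockOne_apply, sub_mul, one_mul, Matrix.sub_apply, blockOne_mul_apply]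
  split_ifs <;> first | omega | simp

theorem trace_blockOne (hk : k ≤ n) : (blockOne n k).trace = k := by
  rw [blockOne, trace_diagonal, ← sum_castLE hk fun _ => (1 : ℂ)]
  simp

theorem IsBasePoint.eig_sub_eig_ne_zero {H₀ : Herm n} (h : IsBasePoint k H₀)
    {i j : Fin n} (hij : ¬((i : ℕ) < k ↔ (j : ℕ) < k)) : (eig H₀ j - eig H₀ i : ℂ) ≠ 0 := by
  rw [sub_ne_zero, Ne, Complex.ofReal_inj]
  by_cases hi : (i : ℕ) < k
  · exact ((h.mem i j hi).2 (by omega)).ne'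
  · exact ((h.mem j i (by omega)).2 (by omega)).ne

namespace SWData

theorem finiteDimensional : FiniteDimensional ℝ (SWData n k) := Module.Finite.prod

/-- The exponent `iS` as a linear function of the data. -/
noncomputable def exponent : SWData n k →ₗ[ℝ] Matrix (Fin n) (Fin n) ℂ where
  toFun p := Complex.I • p.S
  map_add' _ _ := smul_add _ _ _
  map_smul' _ _ := smul_comm _ _ _

/-- The block diagonal perturbation `B + T + H_eff` as a linear function of the data. -/
noncomputable def block : SWData n k →ₗ[ℝ] Herm n where
  toFun p := p.2.1.1 + p.2.2.1 • ⟨blockOne n k, isStarProjection_blockOne.isSelfAdjoint⟩ +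
    p.2.2.2.1
  map_add' p q := by
    simp only [Prod.snd_add, Prod.fst_add, Submodule.coe_add, add_smul]
    abel
  map_smul' c p := by
    simp only [Prod.smul_snd, Prod.smul_fst, Submodule.coe_smul, smul_eq_mul, mul_smul, smul_add,
      RingHom.id_apply]

theorem mat_block (p : SWData n k) : (block p).mat = p.B + p.T + p.eff.1.mat := by
  rw [T, Complex.coe_smul]
  rfl

/-- The Hermitian matrix `H₀ + B + T + H_eff`. -/
noncomputable def blockHerm (H₀ : Herm n) (p : SWData n k) : Herm n := H₀ + block p

theorem mat_blockHerm (H₀ : Herm n) (p : SWData n k) : (p.blockHerm H₀).mat = p.blockMat H₀ := by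
  change H₀.mat + (block p).mat = _
  rw [mat_block, ← add_assoc, ← add_assoc]

theorem blockHerm_zero (H₀ : Herm n) : (0 : SWData n k).blockHerm H₀ = H₀ := by
  rw [blockHerm, map_zero, add_zero]

theorem analyticAt_blockHerm (H₀ : Herm n) (p : SWData n k) : AnalyticAt ℝ (blockHerm H₀) p := by
  have := finiteDimensional (n := n) (k := k)
  have hblock : blockHerm H₀ =
      fun p => H₀ + LinearMap.toContinuousLinearMap (block (n := n) (k := k)) p := rfl
  rw [hblock]
  exact analyticAt_const.fun_add (ContinuousLinearMap.analyticAt _ _)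

/-- The Hermitian matrix `e^{iS} (H₀ + B + T + H_eff) e^{-iS}`. -/
noncomputable def toHerm (H₀ : Herm n) (p : SWData n k) : Herm n :=
  Herm.conj (NormedSpace.exp (Complex.I • p.S)) (p.blockHerm H₀)

theorem mat_toHerm (H₀ : Herm n) (p : SWData n k) :
    (p.toHerm H₀).mat = NormedSpace.exp (Complex.I • p.S) * p.blockMat H₀ *
      NormedSpace.exp (-(Complex.I • p.S)) := by
  rw [toHerm, Herm.mat_conj, mat_blockHerm, star_exp]

theorem toHerm_zero (H₀ : Herm n) : (0 : SWData n k).toHerm H₀ = H₀ := by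
  refine Subtype.ext ?_
  rw [toHerm, blockHerm_zero]
  change NormedSpace.exp (exponent (0 : SWData n k)) * H₀.mat *
    star (NormedSpace.exp (exponent (0 : SWData n k))) = H₀.mat
  rw [map_zero, NormedSpace.exp_zero, star_one, one_mul, mul_one]

theorem eig_toHerm (H₀ : Herm n) (p : SWData n k) :
    eig (p.toHerm H₀) = eig (p.blockHerm H₀) :=
  eig_conj p.exp_mem_unitary _

/-- The derivative of `SWData.toHerm H₀` at `0`: `p ↦ [iS, H₀] + B + T + H_eff`. -/
noncomputable def deriv (H₀ : Herm n) : SWData n k →ₗ[ℝ] Herm n :=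
  LinearMap.codRestrict _
    (LinearMap.mulRight ℝ H₀.mat ∘ₗ exponent - LinearMap.mulLeft ℝ H₀.mat ∘ₗ exponent +
      Submodule.subtype _ ∘ₗ block)
    fun p => by
      refine Submodule.add_mem _ ?_ (block p).2
      have hS : star (exponent p) = -exponent p := skewAdjoint.mem_iff.1
        (IsSelfAdjoint.smul_mem_skewAdjoint Complex.conj_I p.1.1.2)
      have hH₀ : star H₀.mat = H₀.mat := H₀.2
      change star (exponent p * H₀.mat - H₀.mat * exponent p) = _
      rw [star_sub, star_mul, star_mul, hS, hH₀, mul_neg, neg_mul, sub_neg_eq_add, neg_add_eq_sub]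
      rfl

theorem mat_deriv (H₀ : Herm n) (p : SWData n k) : (deriv H₀ p).mat =
    exponent p * H₀.mat - H₀.mat * exponent p + (block p).mat := rfl

variable {H₀ : Herm n}

theorem deriv_apply (h : IsBasePoint k H₀) (p : SWData n k) (i j : Fin n) :
    (deriv H₀ p).mat i j = Complex.I * p.S i j * (eig H₀ j - eig H₀ i) + (block p).mat i j := by
  rw [mat_deriv, h.mat_eq_diagonal, Matrix.add_apply, Matrix.sub_apply, mul_diagonal, diagonal_mul,
    mul_sub, mul_comm (eig H₀ i : ℂ)]
  rfl

theorem deriv_apply_of_iff (h : IsBasePoint k H₀) (p : SWData n k) {i j : Fin n}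
    (hij : (i : ℕ) < k ↔ (j : ℕ) < k) : (deriv H₀ p).mat i j = (block p).mat i j := by
  have hS : p.S i j = 0 := p.1.2 i j hij
  rw [deriv_apply h, hS, mul_zero, zero_mul, zero_add]

theorem block_apply_of_not_iff (p : SWData n k) {i j : Fin n}
    (hij : ¬((i : ℕ) < k ↔ (j : ℕ) < k)) : (block p).mat i j = 0 := by
  have hB : p.B i j = 0 := p.2.1.2 i j (by omega)
  have hE : p.eff.1.mat i j = 0 := p.eff.2.1 i j (by omega)
  have hne : i ≠ j := by
    rintro rfl
    exact hij Iff.rfl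
  rw [mat_block, Matrix.add_apply, Matrix.add_apply, hB, hE, T, blockOne, Matrix.smul_apply,
    diagonal_apply_ne _ hne, smul_zero, add_zero, add_zero]

theorem deriv_apply_of_not_iff (h : IsBasePoint k H₀) (p : SWData n k) {i j : Fin n}
    (hij : ¬((i : ℕ) < k ↔ (j : ℕ) < k)) :
    (deriv H₀ p).mat i j = Complex.I * p.S i j * (eig H₀ j - eig H₀ i) := by
  rw [deriv_apply h, block_apply_of_not_iff p hij, add_zero]

theorem snd_eq_zero_of_block_eq_zero (hk₁ : 1 ≤ k) (hk : k ≤ n) {p : SWData n k}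
    (hp : block p = 0) : p.2 = 0 := by
  have hsum : p.B + p.T + p.eff.1.mat = 0 := (mat_block p).symm.trans (congrArg Herm.mat hp)
  have hB : p.B = 0 := by
    ext i j
    by_cases hij : (i : ℕ) < k ∨ (j : ℕ) < k
    · exact p.2.1.2 i j hij
    · push Not at hij
      have hT : p.T i j = 0 := by
        rw [T, blockOne, Matrix.smul_apply, diagonal_apply, if_neg (not_lt.2 hij.1),
          ite_self, smul_zero]
      have hE : p.eff.1.mat i j = 0 := p.eff.2.1 i j (Or.inl hij.1)
      have hent := congrArg (fun A : Matrix (Fin n) (Fin n) ℂ => A i j) hsum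
      simpa only [Matrix.add_apply, hT, hE, add_zero, Matrix.zero_apply] using hent
  rw [hB, zero_add] at hsum
  have hc : p.2.2.1 = 0 := by
    have htrace := congrArg trace hsum
    rw [trace_add, p.eff.2.2, T, trace_smul, trace_blockOne hk, add_zero, trace_zero,
      smul_eq_mul, mul_eq_zero] at htrace
    simpa [show k ≠ 0 by omega] using htrace
  rw [T, hc, Complex.ofReal_zero, zero_smul, zero_add] at hsum
  exact Prod.ext (Subtype.ext (Subtype.ext hB)) (Prod.ext hc (Subtype.ext (Subtype.ext hsum)))

theorem deriv_injective (hk₁ : 1 ≤ k) (hk : k ≤ n) (h : IsBasePoint k H₀) :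
    Function.Injective (deriv H₀ : SWData n k →ₗ[ℝ] Herm n) := by
  refine (injective_iff_map_eq_zero _).2 fun p hp => ?_
  have hent (i j : Fin n) : (deriv H₀ p).mat i j = 0 := by
    rw [hp]
    rfl
  have hS : p.1 = 0 := by
    refine Subtype.ext (Subtype.ext ?_)
    ext i j
    by_cases hij : (i : ℕ) < k ↔ (j : ℕ) < k
    · exact p.1.2 i j hij
    · have hij' := hent i j
      rw [deriv_apply_of_not_iff h p hij] at hij'
      simpa [h.eig_sub_eig_ne_zero hij] using hij'
  have hblock : block p = 0 := by
    refine Subtype.ext ?_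
    ext i j
    by_cases hij : (i : ℕ) < k ↔ (j : ℕ) < k
    · exact (deriv_apply_of_iff h p hij).symm.trans (hent i j)
    · exact block_apply_of_not_iff p hij
  exact Prod.ext hS (snd_eq_zero_of_block_eq_zero hk₁ hk hblock)

theorem exists_offBlock_apply_eq (h : IsBasePoint k H₀) (X : Herm n) :
    ∃ S : offBlock n k, ∀ i j : Fin n, ¬((i : ℕ) < k ↔ (j : ℕ) < k) →
      Complex.I * S.1.mat i j * (eig H₀ j - eig H₀ i) = X.mat i j := by
  let S : Matrix (Fin n) (Fin n) ℂ := of fun i j => if (i : ℕ) < k ↔ (j : ℕ) < k then 0 else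
    X.mat i j / (Complex.I * (eig H₀ j - eig H₀ i))
  have hS : S.IsHermitian := by
    refine IsHermitian.ext fun i j => ?_
    by_cases hij : (i : ℕ) < k ↔ (j : ℕ) < k
    · simp [S, hij]
    · have hX := X.isHermitian.apply i j
      rw [RCLike.star_def] at hX
      simp [S, hij, iff_comm.not.1 hij, hX]
      ring
  refine ⟨⟨⟨S, hS⟩, fun _ _ hij => if_pos hij⟩, fun i j hij => ?_⟩
  have hSij : S i j = X.mat i j / (Complex.I * (eig H₀ j - eig H₀ i)) := if_neg hij
  have hne := h.eig_sub_eig_ne_zero hij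
  change Complex.I * S i j * _ = _
  rw [hSij]
  field_simp [Complex.I_ne_zero]

theorem exists_block_apply_eq (hk₁ : 1 ≤ k) (hk : k ≤ n) (X : Herm n) :
    ∃ q : lowerBlock n k × ℝ × hermZero n k, ∀ S : offBlock n k, ∀ i j : Fin n,
      ((i : ℕ) < k ↔ (j : ℕ) < k) → (block (S, q)).mat i j = X.mat i j := by
  let U := Herm.conj (blockOne n k) X
  let c : ℝ := U.mat.trace.re / k
  let P : Herm n := ⟨blockOne n k, isStarProjection_blockOne.isSelfAdjoint⟩
  have hE : U - c • P ∈ hermZero n k := by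
    refine ⟨fun i j hij => ?_, ?_⟩
    · have hP : P.mat i j = 0 := by
        change blockOne n k i j = 0
        rw [blockOne, diagonal_apply]
        split_ifs with h
        · omega
        · rfl
        · rfl
      change U.mat i j - c • P.mat i j = 0
      rw [hP, conj_blockOne_apply, if_neg (by omega), smul_zero, sub_zero]
    · have hreal : star U.mat.trace = U.mat.trace := by
        rw [← trace_conjTranspose, U.isHermitian]
      have hk0 : (k : ℝ) ≠ 0 := by positivity
      change (U.mat - c • blockOne n k).trace = 0
      rw [trace_sub, trace_smul, trace_blockOne hk, ← Complex.conj_eq_iff_re.1 hreal,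
        Complex.real_smul, sub_eq_zero]
      exact_mod_cast (div_mul_cancel₀ _ hk0).symm
  have hB : Herm.conj (1 - blockOne n k) X ∈ lowerBlock n k := fun i j hij =>
    (conj_one_sub_blockOne_apply X i j).trans (if_pos hij)
  refine ⟨(⟨_, hB⟩, c, ⟨_, hE⟩), fun S i j hij => ?_⟩
  change (Herm.conj (1 - blockOne n k) X).mat i j + c • P.mat i j + (U.mat i j - c • P.mat i j) = _
  rw [add_add_sub_cancel, conj_one_sub_blockOne_apply, conj_blockOne_apply]
  split_ifs <;> first | omega | simp

theorem deriv_surjective (hk₁ : 1 ≤ k) (hk : k ≤ n) (h : IsBasePoint k H₀) :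
    Function.Surjective (deriv H₀ : SWData n k →ₗ[ℝ] Herm n) := by
  intro X
  obtain ⟨S, hS⟩ := exists_offBlock_apply_eq h X
  obtain ⟨q, hq⟩ := exists_block_apply_eq hk₁ hk X
  refine ⟨(S, q), Subtype.ext ?_⟩
  ext i j
  by_cases hij : (i : ℕ) < k ↔ (j : ℕ) < k
  · exact (deriv_apply_of_iff h _ hij).trans (hq S i j hij)
  · exact (deriv_apply_of_not_iff h _ hij).trans (hS i j hij)

theorem exists_openPartialHomeomorph_toHerm (hk₁ : 1 ≤ k) (hk : k ≤ n) (h : IsBasePoint k H₀) :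
    ∃ Φ : OpenPartialHomeomorph (SWData n k) (Herm n), 0 ∈ Φ.source ∧ ⇑Φ = toHerm H₀ ∧
      AnalyticAt ℝ Φ.symm H₀ := by
  have := finiteDimensional (n := n) (k := k)
  have hf (p : SWData n k) : (p.toHerm H₀).mat =
      NormedSpace.exp (exponent p) * (H₀.mat + (block p).mat) * NormedSpace.exp (-exponent p) := by
    rw [mat_toHerm, mat_block, ← add_assoc, ← add_assoc]
    rfl
  let D : SWData n k ≃ₗ[ℝ] Herm n :=
    .ofBijective (deriv H₀) ⟨deriv_injective hk₁ hk h, deriv_surjective hk₁ hk h⟩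
  have hinv := exists_openPartialHomeomorph_exp_conj (E := SWData n k)
    (A := Matrix (Fin n) (Fin n) ℂ) (K := selfAdjoint.submodule ℝ _) (a := H₀.mat)
    (f := toHerm H₀) exponent (Submodule.subtype _ ∘ₗ block)
  obtain ⟨Φ, h0, hΦ, hanalytic⟩ := hinv hf D (mat_deriv H₀)
  exact ⟨Φ, h0, hΦ, toHerm_zero (k := k) H₀ ▸ hanalytic⟩

end SWData

end DecompositionMap

/-! ### Existence of the decomposition -/

section Existence

variable {n k m : ℕ}

/-- The eigenvalues of the upper left `k × k` block lie below those of the lower right `m × m`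
block. -/
def HasBlockGap (X : Herm (k + m)) : Prop :=
  ∀ i j, eig (Herm.submatrix (Fin.castAdd m) X) i < eig (Herm.submatrix (Fin.natAdd k) X) j

theorem isOpen_setOf_hasBlockGap : IsOpen {X : Herm (k + m) | HasBlockGap X} := by
  simp only [HasBlockGap, Set.ofPred_forall]
  exact isOpen_iInter_of_finite fun i => isOpen_iInter_of_finite fun j => isOpen_lt
    ((continuous_eig i).comp (LinearMap.continuous_of_finiteDimensional _))
    ((continuous_eig j).comp (LinearMap.continuous_of_finiteDimensional _))

theorem submatrix_ofDiagonalization_one {e : Fin m → Fin n} (he : Function.Injective e)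
    (f : Fin n → ℝ) :
    Herm.submatrix e (ofDiagonalization 1 f) = ofDiagonalization 1 (f ∘ e) := by
  refine Subtype.ext ?_
  change (Herm.submatrix e _).mat = (ofDiagonalization _ _).mat
  simp only [Herm.mat_submatrix, mat_ofDiagonalization, star_one, one_mul, mul_one]
  exact submatrix_diagonal _ e he

theorem eig_submatrix_ofDiagonalization_one {e : Fin m → Fin n} (he : StrictMono e) {f : Fin n → ℝ}
    (hf : Monotone f) : eig (Herm.submatrix e (ofDiagonalization 1 f)) = f ∘ e := by
  rw [submatrix_ofDiagonalization_one he.injective,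
    eig_ofDiagonalization (one_mem _) (hf.comp he.monotone)]

theorem IsBasePoint.hasBlockGap {H₀ : Herm (k + m)} (h : IsBasePoint k H₀) : HasBlockGap H₀ := by
  intro i j
  rw [h.eq_ofDiagonalization,
    eig_submatrix_ofDiagonalization_one (Fin.strictMono_castAdd m) (eig_monotone _),
    eig_submatrix_ofDiagonalization_one (Fin.strictMono_natAdd k) (eig_monotone _)]
  exact (h.mem _ _ i.2).2 (Nat.le_add_right k j)

theorem IsBasePoint.blockHerm_apply_eq_zero {H₀ : Herm (k + m)} (h : IsBasePoint k H₀)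
    (p : SWData (k + m) k) (i : Fin k) (j : Fin m) :
    (p.blockHerm H₀).mat (Fin.castAdd m i) (Fin.natAdd k j) = 0 := by
  have hij : ¬(((Fin.castAdd m i : Fin (k + m)) : ℕ) < k ↔
      ((Fin.natAdd k j : Fin (k + m)) : ℕ) < k) := by
    simp
  have hne : Fin.castAdd m i ≠ Fin.natAdd k j := fun hc => hij (by rw [hc])
  have hH₀ : H₀.mat (Fin.castAdd m i) (Fin.natAdd k j) = 0 := h.diag hne
  change H₀.mat _ _ + (SWData.block p).mat _ _ = 0
  rw [hH₀, SWData.block_apply_of_not_iff p hij, add_zero]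

theorem append_lt_append {α : Type*} [LT α] {a : Fin k → α} {b : Fin m → α}
    (h : ∀ i j, a i < b j) {i j : Fin (k + m)} (hi : (i : ℕ) < k) (hj : k ≤ (j : ℕ)) :
    Fin.append a b i < Fin.append a b j := by
  induction i using Fin.addCases with
  | left i =>
    induction j using Fin.addCases with
    | left j => exact absurd hj (not_le.2 j.2)
    | right j => simpa only [Fin.append_left, Fin.append_right] using h i j
  | right i => exact absurd hi (not_lt.2 (Nat.le_add_right k i))

theorem IsBasePoint.isSWDecomposition_toHerm {H₀ : Herm (k + m)} (h : IsBasePoint k H₀)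
    {p : SWData (k + m) k} (hp : HasBlockGap (p.blockHerm H₀)) :
    IsSWDecomposition (Nat.le_add_right k m) H₀ (p.toHerm H₀) p := by
  have hoff := h.blockHerm_apply_eq_zero p
  have heig : eig (p.toHerm H₀) = _ :=
    (p.eig_toHerm H₀).trans (eig_of_blockDiagonal hoff fun i j => (hp i j).le)
  obtain ⟨W, hW, hWc, hX⟩ := exists_eq_ofDiagonalization_append hoff
  rw [← heig] at hX
  have hH : p.toHerm H₀ =
      ofDiagonalization (NormedSpace.exp (Complex.I • p.S) * W) (eig (p.toHerm H₀)) := by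
    rw [← conj_ofDiagonalization, ← hX]
    rfl
  refine ⟨p.mat_toHerm H₀, ?_⟩
  rw [← span_col_mul_unitary _ hW hWc,
    span_col_eq_iSup_eigenspace _ (mul_mem p.exp_mem_unitary hW) (f := eig (p.toHerm H₀)), ← hH]
  · rfl
  · intro i j hi hj
    rw [heig]
    exact append_lt_append hp hi hj

theorem isOpen_setOf_analyticAt {E F : Type*} [NormedAddCommGroup E] [NormedSpace ℝ E]
    [NormedAddCommGroup F] [NormedSpace ℝ F] [FiniteDimensional ℝ F] (f : E → F) :
    IsOpen {x | AnalyticAt ℝ f x} :=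
  have := FiniteDimensional.complete ℝ F
  isOpen_analyticAt ℝ f

theorem nonempty_SWDomain (hk₁ : 1 ≤ k) (hk : k ≤ n) {H₀ : Herm n} (h : IsBasePoint k H₀) :
    Nonempty (SWDomain hk H₀) := by
  obtain ⟨m, rfl⟩ := Nat.exists_eq_add_of_le hk
  obtain ⟨Φ, h0, hΦ, hanalytic⟩ := SWData.exists_openPartialHomeomorph_toHerm hk₁ hk h
  have hΦ0 : Φ 0 = H₀ := by rw [hΦ, SWData.toHerm_zero]
  have hsymm : Φ.symm H₀ = 0 := by rw [← hΦ0, Φ.left_inv h0]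
  have := SWData.finiteDimensional (n := k + m) (k := k)
  let G : Set (SWData (k + m) k) := {p | HasBlockGap (p.blockHerm H₀)}
  have hG : IsOpen G := isOpen_setOf_hasBlockGap.preimage <| continuous_iff_continuousAt.2 fun p =>
    (SWData.analyticAt_blockHerm H₀ p).continuousAt
  have h0G : 0 ∈ G := by
    change HasBlockGap (SWData.blockHerm H₀ 0)
    rw [SWData.blockHerm_zero]
    exact h.hasBlockGap
  exact ⟨{
    V := (Φ.target ∩ Φ.symm ⁻¹' G) ∩ {H | AnalyticAt ℝ Φ.symm H}
    U := Φ.source ∩ G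
    isOpen_V := (Φ.isOpen_inter_preimage_symm hG).inter (isOpen_setOf_analyticAt Φ.symm)
    base_mem := ⟨⟨hΦ0 ▸ Φ.map_source h0, Set.mem_preimage.2 (hsymm ▸ h0G)⟩, hanalytic⟩
    isOpen_U := Φ.open_source.inter hG
    zero_mem := ⟨h0, h0G⟩
    data := Φ.symm
    data_mem := fun H hH => ⟨Φ.map_target hH.1.1, hH.1.2⟩
    isDecomposition := fun H hH => by
      have hdec := h.isSWDecomposition_toHerm (p := Φ.symm H) hH.1.2
      rwa [← hΦ, Φ.right_inv hH.1.1] at hdec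
    unique := fun H _ p hp hd => by
      have hpH : p.toHerm H₀ = H := Subtype.ext ((p.mat_toHerm H₀).trans hd.eq.symm)
      rw [← hpH, ← hΦ, Φ.left_inv hp.1]
    analytic := fun H hH => hH.2 }⟩

end Existence

/-! ### Power series for the ordered eigenvalues -/

section Rellich

theorem exists_eventuallyEq_pow_smul_add_smul {𝕜 E : Type*} [NontriviallyNormedField 𝕜]
    [NormedAddCommGroup E] [NormedSpace 𝕜 E] [SeparatingDual 𝕜 E] {F : 𝕜 → E} {z₀ : 𝕜} {v : E}
    (hF : AnalyticAt 𝕜 F z₀) (hv : v ≠ 0) :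
    ∃ c : 𝕜 → 𝕜, AnalyticAt 𝕜 c z₀ ∧ (F =ᶠ[𝓝 z₀] (fun z => c z • v) ∨
      ∃ (N : ℕ) (g : 𝕜 → E), AnalyticAt 𝕜 g z₀ ∧ (∀ a : 𝕜, g z₀ ≠ a • v) ∧
        F =ᶠ[𝓝 z₀] fun z => (z - z₀) ^ N • g z + c z • v) := by
  obtain ⟨φ, hφ⟩ := SeparatingDual.exists_eq_one (R := 𝕜) hv
  have hc : AnalyticAt 𝕜 (fun z => φ (F z)) z₀ := (φ.analyticAt _).fun_comp hF
  have hG := hF.fun_sub (hc.fun_smul (analyticAt_const (v := v)))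
  refine ⟨fun z => φ (F z), hc, ?_⟩
  by_cases htop : analyticOrderAt (fun z => F z - φ (F z) • v) z₀ = ⊤
  · exact .inl ((analyticOrderAt_eq_top.1 htop).mono fun z hz => sub_eq_zero.1 hz)
  obtain ⟨N, hN⟩ := ENat.ne_top_iff_exists.1 htop
  obtain ⟨g, hg, hg0, hFg⟩ := hG.analyticOrderAt_eq_natCast.1 hN.symm
  refine .inr ⟨N, g, hg, fun a ha => hg0 ?_, hFg.mono fun z hz => sub_eq_iff_eq_add.1 hz⟩
  have hφg : φ (g z₀) = 0 := by
    have hlim := (φ.continuous.continuousAt.comp hg.continuousAt).mono_left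
      (nhdsWithin_le_nhds (s := {z₀}ᶜ))
    refine tendsto_nhds_unique hlim (tendsto_const_nhds.congr' ?_)
    filter_upwards [hFg.filter_mono nhdsWithin_le_nhds, self_mem_nhdsWithin] with z hz hz0
    have hφz := congrArg φ hz
    rw [map_sub, map_smul, hφ, map_smul, smul_eq_mul, smul_eq_mul, mul_one, sub_self] at hφz
    exact ((mul_eq_zero.1 hφz.symm).resolve_left (pow_ne_zero N (sub_ne_zero.2 hz0))).symm
  rw [ha, map_smul, hφ, smul_eq_mul, mul_one] at hφg
  rw [ha, hφg, zero_smul]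

variable {n k m : ℕ}

/-- The identity matrix as a Hermitian matrix. -/
def Herm.one (n : ℕ) : Herm n := ⟨1, star_one _⟩

theorem ofDiagonalization_mul_add {W : Matrix (Fin n) (Fin n) ℂ} (hW : W ∈ unitaryGroup (Fin n) ℂ)
    (f : Fin n → ℝ) (s c : ℝ) : ofDiagonalization W (fun i => s * f i + c) =
      s • ofDiagonalization W f + c • Herm.one n := by
  refine Subtype.ext ?_
  change (ofDiagonalization W _).mat = s • (ofDiagonalization W f).mat + c • 1
  have hdiag : diagonal (fun i => ((s * f i + c : ℝ) : ℂ)) =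
      s • diagonal (fun i => (f i : ℂ)) + c • 1 := by
    rw [← diagonal_one, ← diagonal_smul, ← diagonal_smul, diagonal_add]
    simp
  simp only [mat_ofDiagonalization, hdiag, mul_add, add_mul, Matrix.mul_smul, Matrix.smul_mul,
    mul_one, Unitary.mul_star_self_of_mem hW]

theorem eig_smul_add {s : ℝ} (hs : 0 ≤ s) (c : ℝ) (X : Herm n) (i : Fin n) :
    eig (s • X + c • Herm.one n) i = s * eig X i + c := by
  obtain ⟨W, hW, hX⟩ := exists_eq_ofDiagonalization_eig X
  conv_lhs => rw [hX, ← ofDiagonalization_mul_add hW]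
  exact congrFun (eig_ofDiagonalization hW fun a b hab =>
    add_le_add_left (mul_le_mul_of_nonneg_left (eig_monotone X hab) hs) c) i

theorem eq_smul_one_of_eig_eq {X : Herm n} {c : ℝ} (h : ∀ i, eig X i = c) :
    X = c • Herm.one n := by
  obtain ⟨W, hW, hX⟩ := exists_eq_ofDiagonalization_eig X
  have hconst : eig X = fun i => 0 * eig X i + c := funext fun i => by rw [h i, zero_mul, zero_add]
  rw [hX, hconst, ofDiagonalization_mul_add hW, zero_smul, zero_add]

theorem exists_mem_degenerate {X : Herm n} (hX : ∀ c : ℝ, X ≠ c • Herm.one n) :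
    ∃ k, 1 ≤ k ∧ k < n ∧ X ∈ degenerate n k := by
  have hn : n ≠ 0 := by
    rintro rfl
    exact hX 0 (Subtype.ext (Subsingleton.elim _ _))
  have : NeZero n := ⟨hn⟩
  have hne : {j | eig X j ≠ eig X 0}.Nonempty := by
    by_contra! hcon
    exact hX _ (eq_smul_one_of_eig_eq fun j => of_not_not (Set.eq_empty_iff_forall_notMem.1 hcon j))
  obtain ⟨k, hk, hmin⟩ := wellFounded_lt.has_min _ hne
  have hlow (j : Fin n) (hj : (j : ℕ) < k) : eig X j = eig X 0 := of_not_not fun hc => hmin j hc hj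
  have hhigh (j : Fin n) (hj : (k : ℕ) ≤ j) : eig X 0 < eig X j :=
    ((eig_monotone X (Fin.zero_le k)).lt_of_ne' hk).trans_le (eig_monotone X hj)
  refine ⟨k, Nat.one_le_iff_ne_zero.2 fun h0 => hk (congrArg _ (Fin.ext h0)), k.2,
    fun i j hi => ⟨fun hj => (hlow i hi).trans (hlow j hj).symm, fun hj => ?_⟩⟩
  rw [hlow i hi]
  exact hhigh j hj

theorem exists_isBasePoint_conj {X : Herm n} (hX : X ∈ degenerate n k) :
    ∃ U ∈ unitaryGroup (Fin n) ℂ, IsBasePoint k (Herm.conj U X) := by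
  obtain ⟨W, hW, hXW⟩ := exists_eq_ofDiagonalization_eig X
  have hU : star W ∈ unitaryGroup (Fin n) ℂ := Unitary.star_mem hW
  have hmat : (Herm.conj (star W) X).mat = diagonal fun i => (eig X i : ℂ) := by
    conv_lhs => rw [hXW, conj_ofDiagonalization, Unitary.star_mul_self_of_mem hW]
    rw [mat_ofDiagonalization, star_one, one_mul, mul_one]
  refine ⟨star W, hU, ?_, ?_, ?_⟩
  · simpa only [degenerate, Set.mem_ofPred_eq, eig_conj hU] using hX
  · rw [hmat]
    exact isDiag_diagonal _
  · simpa only [hmat, diagonal_apply_eq, Complex.ofReal_re] using eig_monotone X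

theorem IsBasePoint.exists_analyticAt_eig_eq_append (hk₁ : 1 ≤ k) {H₀ : Herm (k + m)}
    (h : IsBasePoint k H₀) :
    ∃ X : Herm (k + m) → Herm (k + m), AnalyticAt ℝ X H₀ ∧ ∀ᶠ H in 𝓝 H₀, eig H =
      Fin.append (eig (Herm.submatrix (Fin.castAdd m) (X H)))
        (eig (Herm.submatrix (Fin.natAdd k) (X H))) := by
  obtain ⟨Φ, h0, hΦ, hsymm⟩ :=
    SWData.exists_openPartialHomeomorph_toHerm hk₁ (Nat.le_add_right k m) h
  have hΦ0 : Φ 0 = H₀ := by rw [hΦ, SWData.toHerm_zero]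
  have hX : AnalyticAt ℝ (fun H => (Φ.symm H).blockHerm H₀) H₀ :=
    (SWData.analyticAt_blockHerm H₀ _).fun_comp hsymm
  refine ⟨_, hX, ?_⟩
  have hgap : ∀ᶠ H in 𝓝 H₀, HasBlockGap ((Φ.symm H).blockHerm H₀) := by
    refine hX.continuousAt.eventually_mem (isOpen_setOf_hasBlockGap.mem_nhds ?_)
    rw [← hΦ0, Φ.left_inv h0, SWData.blockHerm_zero, hΦ0]
    exact h.hasBlockGap
  filter_upwards [Φ.open_target.mem_nhds (hΦ0 ▸ Φ.map_source h0), hgap] with H htarget hH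
  rw [← eig_of_blockDiagonal (h.blockHerm_apply_eq_zero _) fun i j => (hH i j).le,
    ← SWData.eig_toHerm, ← hΦ, Φ.right_inv htarget]

theorem rightAnalytic_eig_of_mem_degenerate (hk₁ : 1 ≤ k) {A : ℝ → Herm (k + m)}
    (hA : AnalyticAt ℝ A 0) (hA₀ : A 0 ∈ degenerate (k + m) k)
    (ihk : ∀ B : ℝ → Herm k, AnalyticAt ℝ B 0 → ∀ i, RightAnalytic fun t => eig (B t) i)
    (ihm : ∀ B : ℝ → Herm m, AnalyticAt ℝ B 0 → ∀ i, RightAnalytic fun t => eig (B t) i)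
    (i : Fin (k + m)) : RightAnalytic fun t => eig (A t) i := by
  have hlin {p q : ℕ} (f : Herm p →ₗ[ℝ] Herm q) {B : ℝ → Herm p} (hB : AnalyticAt ℝ B 0) :
      AnalyticAt ℝ (fun t => f (B t)) 0 := (f.toContinuousLinearMap.analyticAt _).fun_comp hB
  obtain ⟨U, hU, hbase⟩ := exists_isBasePoint_conj hA₀
  obtain ⟨X, hX, heig⟩ := hbase.exists_analyticAt_eig_eq_append hk₁
  have hconj := hlin (Herm.conj U) hA
  have hXA : AnalyticAt ℝ (fun t => X (Herm.conj U (A t))) 0 :=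
    hX.fun_comp (f := fun t => Herm.conj U (A t)) hconj
  have heig' : ∀ᶠ t in 𝓝[≥] (0 : ℝ), eig (A t) = _ :=
    ((hconj.continuousAt.eventually heig).filter_mono nhdsWithin_le_nhds).mono fun t ht =>
      (eig_conj hU (A t)).symm.trans ht
  induction i using Fin.addCases with
  | left i =>
    refine (ihk _ (hlin (Herm.submatrix (Fin.castAdd m)) hXA) i).congr (heig'.mono fun t ht => ?_)
    simp only [ht, Fin.append_left]
  | right i =>
    refine (ihm _ (hlin (Herm.submatrix (Fin.natAdd k)) hXA) i).congr (heig'.mono fun t ht => ?_)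
    simp only [ht, Fin.append_right]

theorem rightAnalytic_eig {A : ℝ → Herm n} (hA : AnalyticAt ℝ A 0) (i : Fin n) :
    RightAnalytic fun t => eig (A t) i := by
  induction n using Nat.strong_induction_on with
  | _ n ih =>
    have : Nonempty (Fin n) := ⟨i⟩
    have hone : Herm.one n ≠ 0 := fun h =>
      one_ne_zero (α := Matrix (Fin n) (Fin n) ℂ) (congrArg Herm.mat h)
    obtain ⟨c, hc, hAc | ⟨N, g, hg, hg0, hAg⟩⟩ := exists_eventuallyEq_pow_smul_add_smul hA hone
    · refine (RightAnalytic.of_analyticAt hc).congr ?_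
      filter_upwards [hAc.filter_mono nhdsWithin_le_nhds] with t ht
      have heig := eig_smul_add le_rfl (c t) (0 : Herm n) i
      rwa [zero_smul, zero_add, zero_mul, zero_add, ← ht] at heig
    · obtain ⟨k, hk₁, hkn, hgk⟩ := exists_mem_degenerate hg0
      obtain ⟨m, rfl⟩ := Nat.exists_eq_add_of_le hkn.le
      have hge := rightAnalytic_eig_of_mem_degenerate hk₁ hg hgk (fun _ => ih k hkn)
        (fun _ => ih m (by omega)) i
      have hpow : AnalyticAt ℝ (fun t : ℝ => t ^ N) 0 := by fun_prop
      refine (((RightAnalytic.of_analyticAt hpow).mul hge).add (.of_analyticAt hc)).congr ?_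
      filter_upwards [hAg.filter_mono nhdsWithin_le_nhds, self_mem_nhdsWithin] with t ht ht0
      rw [ht, sub_zero, eig_smul_add (pow_nonneg ht0 N)]

end Rellich

/-! ### Orders along an analytic curve -/

section Orders

variable {n k : ℕ} {H : ℝ → Herm n}

theorem rightAnalytic_lowEig (hk : k ≤ n) (hH : AnalyticAt ℝ H 0) (i : Fin k) :
    RightAnalytic fun t => lowEig hk (H t) i := rightAnalytic_eig hH _

theorem rightAnalytic_splitting (hk : k ≤ n) (hH : AnalyticAt ℝ H 0) (i j : Fin k) :
    RightAnalytic fun t => splitting hk i j (H t) :=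
  (rightAnalytic_lowEig hk hH i).sub (rightAnalytic_lowEig hk hH j)

theorem rightAnalytic_meanSplitting (hk : k ≤ n) (hH : AnalyticAt ℝ H 0) (i : Fin k) :
    RightAnalytic fun t => meanSplitting hk i (H t) := by
  refine (rightAnalytic_lowEig hk hH i).sub ?_
  simp only [meanEig, div_eq_mul_inv]
  exact (RightAnalytic.sum fun j _ => rightAnalytic_lowEig hk hH j).mul
    (.of_analyticAt analyticAt_const)

theorem rightAnalytic_stdDev (hk : k ≤ n) (hH : AnalyticAt ℝ H 0) :
    RightAnalytic fun t => stdDev hk (H t) := by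
  simp only [stdDev, div_eq_mul_inv, Real.sqrt_mul' _ (inv_nonneg.2 (Nat.cast_nonneg k))]
  exact (RightAnalytic.sqrt_sum_sq (rightAnalytic_meanSplitting hk hH)).mul
    (.of_analyticAt analyticAt_const)

theorem natCast_le_rightOrd_splitting_tfae (hk₁ : 1 ≤ k) (hk : k ≤ n) (hH : AnalyticAt ℝ H 0)
    (N : ℕ) : List.TFAE [
      (N : ℕ∞) ≤ rightOrd fun t => stdDev hk (H t),
      N ≤ ⨅ (i : Fin k) (j : Fin k) (_ : i < j), rightOrd fun t => splitting hk i j (H t),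
      N ≤ ⨅ (i : Fin k) (j : Fin k) (_ : (i : ℕ) + 1 = (j : ℕ)),
        rightOrd fun t => splitting hk i j (H t),
      N ≤ rightOrd fun t => splitting hk ⟨0, hk₁⟩ ⟨k - 1, Nat.sub_one_lt_of_lt hk₁⟩ (H t),
      N ≤ ⨅ i : Fin k, rightOrd fun t => meanSplitting hk i (H t)] := by
  simp only [le_iInf_iff, (rightAnalytic_stdDev hk hH).natCast_le_rightOrd_iff,
    (rightAnalytic_splitting hk hH _ _).natCast_le_rightOrd_iff,
    (rightAnalytic_meanSplitting hk hH _).natCast_le_rightOrd_iff]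
  exact splitting_isBigO_tfae hk₁ (l := fun i t => lowEig hk (H t) i)
    fun t a b hab => eig_monotone (H t) ((Fin.strictMono_castLE hk).monotone hab)

theorem isTheta_stdDev {E : Type*} [NormedAddCommGroup E] (hk₁ : 1 ≤ k) (hk : k ≤ n) {F : ℝ → E}
    (h : ∀ᶠ t in 𝓝 (0 : ℝ), ‖F t‖ = √k * stdDev hk (H t)) :
    F =Θ[𝓝[>] 0] fun t => stdDev hk (H t) := by
  have hk0 : √(k : ℝ) ≠ 0 := (Real.sqrt_pos.2 (by exact_mod_cast hk₁)).ne'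
  have hnorm : (fun t => ‖F t‖) =ᶠ[𝓝[>] 0] fun t => √k * stdDev hk (H t) :=
    h.filter_mono nhdsWithin_le_nhds
  exact isTheta_norm_left.1
    (hnorm.trans_isTheta ((isTheta_const_mul_left hk0).2 (isTheta_refl _ _)))

theorem eventually_infDist_degenerate (hk₁ : 1 ≤ k) (hk : k ≤ n) (hH : AnalyticAt ℝ H 0)
    (hH₀ : H 0 ∈ degenerate n k) :
    ∀ᶠ t in 𝓝 (0 : ℝ), Metric.infDist (H t) (degenerate n k) = √k * stdDev hk (H t) :=
  (hH.continuousAt.eventually_mem (isOpen_setOf_hasGap.mem_nhds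
    (hasGap_of_mem_degenerate hH₀))).mono fun _ hgap => hgap.infDist_degenerate hk₁ hk

theorem rightAnalytic_infDist_degenerate (hk₁ : 1 ≤ k) (hk : k ≤ n) (hH : AnalyticAt ℝ H 0)
    (hH₀ : H 0 ∈ degenerate n k) :
    RightAnalytic fun t => Metric.infDist (H t) (degenerate n k) :=
  ((RightAnalytic.of_analyticAt analyticAt_const).mul (rightAnalytic_stdDev hk hH)).congr
    ((eventually_infDist_degenerate hk₁ hk hH hH₀).filter_mono nhdsWithin_le_nhds)

theorem rightOrd_infDist_degenerate (hk₁ : 1 ≤ k) (hk : k ≤ n) (hH : AnalyticAt ℝ H 0)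
    (hH₀ : H 0 ∈ degenerate n k) :
    rightOrd (fun t => Metric.infDist (H t) (degenerate n k)) =
      rightOrd fun t => stdDev hk (H t) := by
  refine (rightAnalytic_infDist_degenerate hk₁ hk hH hH₀).rightOrd_eq_of_isTheta
    (rightAnalytic_stdDev hk hH) (isTheta_stdDev hk₁ hk ?_)
  filter_upwards [eventually_infDist_degenerate hk₁ hk hH hH₀] with t ht
  rw [Real.norm_of_nonneg Metric.infDist_nonneg, ht]

namespace SWDomain

variable {hk : k ≤ n} {H₀ : Herm n} (D : SWDomain hk H₀)

theorem analyticAt_eff (hH : AnalyticAt ℝ H 0) (hD : H 0 ∈ D.V) :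
    AnalyticAt ℝ (fun t => (D.data (H t)).eff) 0 :=
  analyticAt_snd.fun_comp (analyticAt_snd.fun_comp (analyticAt_snd.fun_comp
    ((D.analytic _ hD).fun_comp hH)))

theorem analyticOrderAt_eff (hk₁ : 1 ≤ k) (hH₀ : IsBasePoint k H₀) (hH : AnalyticAt ℝ H 0)
    (hD : H 0 ∈ D.V) :
    analyticOrderAt (fun t => (D.data (H t)).eff) 0 = rightOrd fun t => stdDev hk (H t) := by
  refine analyticOrderAt_eq_rightOrd_of_isTheta (D.analyticAt_eff hH hD)
    (rightAnalytic_stdDev hk hH) (isTheta_stdDev hk₁ hk ?_)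
  filter_upwards [hH.continuousAt.eventually_mem (D.isOpen_V.mem_nhds hD)] with t ht
  exact (D.isDecomposition _ ht).norm_eff hk₁ hH₀

end SWDomain

end Orders

end SchriefferWolff

open SchriefferWolff in
theorem mainTheorem4 (n k : ℕ) (hk₁ : 1 ≤ k) (hk : k ≤ n)
    (H : ℝ → Herm n) (hH : AnalyticAt ℝ H 0) (hH₀ : H 0 ∈ degenerate n k) :
    -- the splitting functions and the distance are power series for `t ≥ 0`
    (RightAnalytic (fun t => stdDev hk (H t)) ∧
      (∀ i j : Fin k, RightAnalytic (fun t => splitting hk i j (H t))) ∧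
      (∀ i : Fin k, RightAnalytic (fun t => meanSplitting hk i (H t))) ∧
      RightAnalytic (fun t => Metric.infDist (H t) (degenerate n k))) ∧
    -- the decomposition is defined near every base point
    (∀ H₀' : Herm n, IsBasePoint k H₀' → Nonempty (SWDomain hk H₀')) ∧
    -- the order `r` of energy splitting, measured in any of the five ways, and its other values
    ∃ r : ℕ∞,
      rightOrd (fun t => stdDev hk (H t)) = r ∧
      (⨅ (i : Fin k) (j : Fin k) (_ : i < j), rightOrd (fun t => splitting hk i j (H t))) = r ∧
      (⨅ (i : Fin k) (j : Fin k) (_ : (i : ℕ) + 1 = (j : ℕ)),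
        rightOrd (fun t => splitting hk i j (H t))) = r ∧
      rightOrd (fun t => splitting hk ⟨0, by omega⟩ ⟨k - 1, by omega⟩ (H t)) = r ∧
      (⨅ i : Fin k, rightOrd (fun t => meanSplitting hk i (H t))) = r ∧
      rightOrd (fun t => Metric.infDist (H t) (degenerate n k)) = r ∧
      ∀ H₀' : Herm n, IsBasePoint k H₀' → ∀ D : SWDomain hk H₀', H 0 ∈ D.V →
        AnalyticAt ℝ (fun t => (D.data (H t)).eff) 0 ∧
        analyticOrderAt (fun t => (D.data (H t)).eff) 0 = r ∧
        ∀ c : Module.Basis (Fin (k ^ 2 - 1)) ℝ (hermZero n k),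
          (∀ j, AnalyticAt ℝ (fun t => c.repr (D.data (H t)).eff j) 0) ∧
          (⨅ j, analyticOrderAt (fun t => c.repr (D.data (H t)).eff j) 0) = r := by
  have htfae := natCast_le_rightOrd_splitting_tfae hk₁ hk hH
  refine ⟨⟨rightAnalytic_stdDev hk hH, rightAnalytic_splitting hk hH,
      rightAnalytic_meanSplitting hk hH, rightAnalytic_infDist_degenerate hk₁ hk hH hH₀⟩,
    fun _ h => nonempty_SWDomain hk₁ hk h,
    rightOrd fun t => stdDev hk (H t), rfl,
    ENat.eq_of_forall_natCast_le_iff fun N => (htfae N).out 1 0,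
    ENat.eq_of_forall_natCast_le_iff fun N => (htfae N).out 2 0,
    ENat.eq_of_forall_natCast_le_iff fun N => (htfae N).out 3 0,
    ENat.eq_of_forall_natCast_le_iff fun N => (htfae N).out 4 0,
    rightOrd_infDist_degenerate hk₁ hk hH hH₀, fun _ hbase D hD => ?_⟩
  have heff := D.analyticAt_eff hH hD
  have hord := D.analyticOrderAt_eff hk₁ hbase hH hD
  exact ⟨heff, hord, fun c => ⟨analyticAt_basis_repr c heff,
    (iInf_analyticOrderAt_basis_repr c heff).trans hord⟩⟩
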